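/- For $E\subset\mathbb R^n$ let $$P(E)=\sup\Big\{\int_E \operatorname{div}\varphi\,dx : \varphi\in C_c^\infty(\mathbb R^n;\mathbb R^n),\ \|\varphi\|_\infty\le 1\Big\}$$ be its perimeter, and let $B_r(x)$ be the open ball of radius $r$ and centre $x$. For bounded open sets $E,F\subset\mathbb R^n$ let $d_{\mathcal H}(E,F)$ be the Hausdorff distance between $D\setminus E$ and $D\setminus F$, where $D$ is any compact set containing $E\cup F$ (it does not depend on $D$, and equals the Hausdorff distance between the complements of $E$ and $F$), and let $d^{\mathcal H}(\overline E,\overline F)$ be the Hausdorff distance between the closures. Put $$\mathcal A_{\mathcal H}(E)=\inf\Big\{\frac{d_{\mathcal H}(E,B_r(x))}{r} : x\in\mathbb R^2,\ r>0,\ P(B_r(x))=P(E)\Big\},$$ and let $\overline{\mathcal A}_{\mathcal H}(E)$ be the same quantity with $d^{\mathcal H}(\overline E,\overline{B_r(x)})$ in place of $d_{\mathcal H}(E,B_r(x))$. There is an absolute constant $C>0$ such that for every nonempty, open, bounded, convex set $E\subset\mathbb R^2$, $$\frac1{(2\pi)^2}-\frac{\inf_{x_0\in\mathbb R^2}\int_{\partial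 E}|x-x_0|^2\,d\mathcal H^1}{P(E)^3}\ \ge\ C\,\mathcal A_{\mathcal H}(E)^2,$$ and the same inequality holds with $\overline{\mathcal A}_{\mathcal H}(E)$ in place of $\mathcal A_{\mathcal H}(E)$. -/

import Mathlib

open MeasureTheory
open scoped ENNReal ContDiff

noncomputable section

/-- The divergence of a vector field `φ` on `ℝⁿ`. -/
def divergence {n : ℕ} (φ : EuclideanSpace ℝ (Fin n) → EuclideanSpace ℝ (Fin n))
    (x : EuclideanSpace ℝ (Fin n)) : ℝ :=
  ∑ i, (fderiv ℝ φ x (EuclideanSpace.single i 1)) i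

/-- The (De Giorgi) perimeter of `E ⊆ ℝⁿ`: the supremum of `∫_E div φ dx` over all smooth
compactly supported vector fields `φ` with `|φ| ≤ 1` everywhere. -/
def perimeter {n : ℕ} (E : Set (EuclideanSpace ℝ (Fin n))) : ℝ≥0∞ :=
  ⨆ φ ∈ {φ : EuclideanSpace ℝ (Fin n) → EuclideanSpace ℝ (Fin n) |
      ContDiff ℝ ∞ φ ∧ HasCompactSupport φ ∧ ∀ x, ‖φ x‖ ≤ 1},
    ENNReal.ofReal (∫ x in E, divergence φ x)

/-- `inf_{x₀} ∫_{∂E} |x - x₀|² dH¹` for a planar set `E`. -/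
def infBoundaryMomentum (E : Set (EuclideanSpace ℝ (Fin 2))) : ℝ :=
  ⨅ x₀ : EuclideanSpace ℝ (Fin 2), ∫ x in frontier E, ‖x - x₀‖ ^ 2 ∂(Measure.hausdorffMeasure 1)

/-- The Hausdorff distance of two bounded open sets, that is, the Hausdorff distance between
their complements. The complements can be taken in any compact set containing both sets, see
`openHausdorffDist_eq`. -/
def openHausdorffDist {n : ℕ} (E F : Set (EuclideanSpace ℝ (Fin n))) : ℝ :=
  Metric.hausdorffDist Eᶜ Fᶜ

/-- The Hausdorff distance between the closures of two sets. -/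
def closureHausdorffDist {n : ℕ} (E F : Set (EuclideanSpace ℝ (Fin n))) : ℝ :=
  Metric.hausdorffDist (closure E) (closure F)

/-- The asymmetry index of `E` with respect to a distance `d` between sets: the infimum of
`d(E, B_r(x)) / r` over all balls `B_r(x)` with the same perimeter as `E`. -/
def asymmetryIndex {n : ℕ}
    (d : Set (EuclideanSpace ℝ (Fin n)) → Set (EuclideanSpace ℝ (Fin n)) → ℝ)
    (E : Set (EuclideanSpace ℝ (Fin n))) : ℝ :=
  sInf {t : ℝ | ∃ (x : EuclideanSpace ℝ (Fin n)) (r : ℝ), 0 < r ∧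
    perimeter (Metric.ball x r) = perimeter E ∧ t = d E (Metric.ball x r) / r}

theorem infEDist_diff_of_mem {n : ℕ} {D F : Set (EuclideanSpace ℝ (Fin n))} (hD : IsClosed D)
    (hF : IsOpen F) (hFD : F ⊆ D) {x : EuclideanSpace ℝ (Fin n)} (hx : x ∈ F) :
    Metric.infEDist x (D \ F) = Metric.infEDist x Fᶜ := by
  apply le_antisymm
  · refine Metric.le_infEDist.2 fun y hy => ?_
    obtain ⟨z, hz, hzF⟩ : (segment ℝ x y ∩ frontier F).Nonempty := by
      by_contra hne
      have key : ∀ z ∈ segment ℝ x y, z ∈ closure F → z ∈ F := fun z hz hzc => by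
        by_contra hzF
        exact hne ⟨z, hz, by rw [hF.frontier_eq]; exact ⟨hzc, hzF⟩⟩
      obtain ⟨z, -, hz1, hz2⟩ := (convex_segment x y).isPreconnected F (closure F)ᶜ hF
        isClosed_closure.isOpen_compl
        (fun z hz => by
          by_cases h : z ∈ closure F
          · exact Or.inl (key z hz h)
          · exact Or.inr h)
        ⟨x, left_mem_segment ℝ x y, hx⟩
        ⟨y, right_mem_segment ℝ x y, fun h => hy (key y (right_mem_segment ℝ x y) h)⟩
      exact hz2 (subset_closure hz1)
    have hzD : z ∈ D \ F :=
      ⟨closure_minimal hFD hD (frontier_subset_closure hzF), by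
        rw [hF.frontier_eq] at hzF; exact hzF.2⟩
    refine (Metric.infEDist_le_edist_of_mem hzD).trans ?_
    have h := dist_add_dist_of_mem_segment hz
    rw [edist_dist, edist_dist]
    exact ENNReal.ofReal_le_ofReal (by linarith [dist_nonneg (x := z) (y := y)])
  · exact Metric.infEDist_anti fun y hy => hy.2

theorem iSup_infEDist_diff {n : ℕ} {D E F : Set (EuclideanSpace ℝ (Fin n))} (hD : IsClosed D)
    (hF : IsOpen F) (hFD : F ⊆ D) :
    ⨆ x ∈ D \ E, Metric.infEDist x (D \ F) = ⨆ x ∈ Eᶜ, Metric.infEDist x Fᶜ := by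
  apply le_antisymm
  · refine iSup₂_le fun x hx => ?_
    by_cases hxF : x ∈ F
    · rw [infEDist_diff_of_mem hD hF hFD hxF]
      exact le_iSup₂_of_le x hx.2 le_rfl
    · rw [Metric.infEDist_zero_of_mem (show x ∈ D \ F from ⟨hx.1, hxF⟩)]
      exact zero_le
  · refine iSup₂_le fun x hx => ?_
    by_cases hxF : x ∈ F
    · rw [← infEDist_diff_of_mem hD hF hFD hxF]
      exact le_iSup₂_of_le x ⟨hFD hxF, hx⟩ le_rfl
    · rw [Metric.infEDist_zero_of_mem (show x ∈ Fᶜ from hxF)]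
      exact zero_le

/-- The Hausdorff distance of two open sets does not depend on the compact set in which the
complements are taken. -/
theorem openHausdorffDist_eq {n : ℕ} {D E F : Set (EuclideanSpace ℝ (Fin n))} (hD : IsCompact D)
    (hE : IsOpen E) (hF : IsOpen F) (hED : E ⊆ D) (hFD : F ⊆ D) :
    Metric.hausdorffDist (D \ E) (D \ F) = openHausdorffDist E F := by
  unfold openHausdorffDist Metric.hausdorffDist
  rw [Metric.hausdorffEDist_def, Metric.hausdorffEDist_def,
    iSup_infEDist_diff hD.isClosed hF hFD, iSup_infEDist_diff hD.isClosed hE hED]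

end

/-! ### Fourier stability of Wirtinger's inequality for Lipschitz loops -/

section FourierStability

open AddCircle Filter Topology

/-! This is Hurwitz's argument in quantitative form. Put `r = P(E) / 2π`. The boundary of `E` is the
image of an `r`-Lipschitz loop on the circle of length `2π` (`exists_boundary_loop`). Let `f` be
this loop, read in `ℂ` and centred at its mean. The boundary momentum about that mean is at most
`2πr` times the mean of `|f|²` (`setIntegral_hausdorffMeasure_range_le`), so the deficit in the
theorem is at least `δ / (2πr)²`, where `δ = r² - mean |f|²`. It suffices to find a disc of radius
`r` within Hausdorff distance `O(√δ)` of `E`.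

Let `cₙ` be the Fourier coefficients of `f`. Bessel's inequality for difference quotients gives `∑
n²|cₙ|² ≤ r²`, and with Parseval `∑ (n² - 1)|cₙ|² ≤ δ`. As `c₀ = 0`, this bounds all modes `|n| ≥
2`, even uniformly after a Cauchy-Schwarz step. It says nothing about `n = ±1`, whose sum traces an
ellipse. To see that the ellipse is almost a circle, the pointwise Lipschitz bound is used and not
only its mean square: by `sq_add_sq_fourierCoeff_le` and `mul_integral_norm_ellipse_le`, the mean
speed of an ellipse falls short of its root mean square by a term of order `|c₁c₋₁|²`, so one of the
two coefficients is `O(√δ)`. The outcome is `exists_lipschitz_loop_near_sphere`: `f` is uniformly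
close to a circle of radius `r` and passes near each of its points. Convexity turns closeness of the
boundary into closeness of closures and of complements (`hausdorffDist_closure_ball_and_compl_le`).

The link with the De Giorgi perimeter needs only one inequality for `E`, namely that the boundary
curve is no longer than `P(E)`. For an inscribed polygon, test fields supported in the disjoint
cones over its sides, each constant in direction, have total flux tending to the length of the
polygon (`sum_dist_le_perimeter`, `eVariationOn_polarCurve_le`). The perimeter of a disc must be
known exactly (`perimeter_ball`), so that the disc found above competes in the infimum. -/

instance fact_two_pi_pos : Fact (0 < 2 * Real.pi) := ⟨Real.two_pi_pos⟩

theorem hasSum_sq_fourierCoeff_continuousMap {T : ℝ} [Fact (0 < T)] (f : C(AddCircle T, ℂ)) :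
    HasSum (fun n => ‖fourierCoeff f n‖ ^ 2) (∫ x, ‖f x‖ ^ 2 ∂haarAddCircle) := by
  have h := hasSum_sq_fourierCoeff (ContinuousMap.toLp (E := ℂ) 2 haarAddCircle ℂ f)
  simp_rw [fourierCoeff_toLp] at h
  convert h using 1
  refine integral_congr_ae ?_
  filter_upwards [ContinuousMap.coeFn_toLp (p := 2) (𝕜 := ℂ) haarAddCircle f] with x hx
  rw [hx]

theorem integrable_of_continuous_addCircle {T : ℝ} [Fact (0 < T)] {E : Type*}
    [NormedAddCommGroup E] {f : AddCircle T → E} (hf : Continuous f) :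
    Integrable f haarAddCircle :=
  hf.integrable_of_hasCompactSupport (HasCompactSupport.of_compactSpace f)

theorem fourierCoeff_comp_add_right {T : ℝ} [Fact (0 < T)] (f : AddCircle T → ℂ)
    (a : AddCircle T) (n : ℤ) :
    fourierCoeff (fun x => f (x + a)) n = fourier n a * fourierCoeff f n := by
  unfold fourierCoeff
  rw [← integral_const_mul,
    ← integral_add_right_eq_self (fun t => fourier n a * fourier (-n) t • f t) a]
  congr 1
  ext t
  have h : fourier n a * fourier (-n) (t + a) = fourier (-n) t := by
    simp only [fourier_apply, ← Circle.coe_mul, ← toCircle_add]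
    congr 2
    simp only [neg_smul, smul_add]
    abel
  rw [smul_eq_mul, smul_eq_mul, ← mul_assoc, h]

theorem fourierCoeff_translate_sub {T : ℝ} [Fact (0 < T)] (f : C(AddCircle T, ℂ))
    (a : AddCircle T) (n : ℤ) :
    fourierCoeff (fun x => f (x + a) - f x) n = (fourier n a - 1) * fourierCoeff f n := by
  rw [sub_mul, one_mul, ← fourierCoeff_comp_add_right]
  unfold fourierCoeff
  rw [← integral_sub]
  · simp_rw [smul_sub]
  · exact integrable_of_continuous_addCircle (by fun_prop)
  · exact integrable_of_continuous_addCircle (by fun_prop)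

/-- Translation multiplies the `n`-th coefficient by a character, so this limit lets difference
quotients stand in for the derivative of a loop that is merely Lipschitz. -/
theorem tendsto_fourier_sub_one_div (n : ℤ) :
    Tendsto (fun h : ℝ => (fourier n (h : AddCircle (2 * Real.pi)) - 1) / (h : ℂ)) (𝓝[≠] 0)
      (𝓝 (Complex.I * n)) := by
  have h := (hasDerivAt_fourier (2 * Real.pi) n 0).tendsto_slope
  have e : 2 * Real.pi * Complex.I * n / ((2 * Real.pi : ℝ) : ℂ) *
      fourier n ((0 : ℝ) : AddCircle (2 * Real.pi)) = Complex.I * n := by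
    have : (Real.pi : ℂ) ≠ 0 := by exact_mod_cast Real.pi_ne_zero
    simp only [QuotientAddGroup.mk_zero, fourier_eval_zero]
    push_cast
    field_simp
  rw [e] at h
  refine h.congr fun x => ?_
  simp only [slope, sub_zero, vsub_eq_sub, QuotientAddGroup.mk_zero, fourier_eval_zero,
    Complex.real_smul]
  push_cast
  field_simp

variable {r : ℝ} {f : C(AddCircle (2 * Real.pi), ℂ)}

/-- Bessel's inequality for the derivative of an `r`-Lipschitz loop. -/
theorem sum_sq_mul_sq_fourierCoeff_le
    (hf : ∀ x (h : ℝ), ‖f (x + h) - f x‖ ≤ r * |h|) (S : Finset ℤ) :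
    ∑ n ∈ S, (n : ℝ) ^ 2 * ‖fourierCoeff f n‖ ^ 2 ≤ r ^ 2 := by
  have key : ∀ h : ℝ, h ≠ 0 →
      ∑ n ∈ S, ‖(fourier n (h : AddCircle (2 * Real.pi)) - 1) / (h : ℂ)‖ ^ 2 *
        ‖fourierCoeff f n‖ ^ 2 ≤ r ^ 2 := by
    intro h hh
    let g : C(AddCircle (2 * Real.pi), ℂ) := ⟨fun x => f (x + h) - f x, by fun_prop⟩
    have h1 := sum_le_hasSum S (fun n _ => sq_nonneg _) (hasSum_sq_fourierCoeff_continuousMap g)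
    have h2 : ∫ x, ‖g x‖ ^ 2 ∂haarAddCircle ≤ (r * |h|) ^ 2 := by
      calc ∫ x, ‖g x‖ ^ 2 ∂haarAddCircle
          ≤ ∫ _x : AddCircle (2 * Real.pi), (r * |h|) ^ 2 ∂haarAddCircle := by
            refine integral_mono (integrable_of_continuous_addCircle (by fun_prop))
              (integrable_const _) fun x => ?_
            exact pow_le_pow_left₀ (norm_nonneg _) (hf x h) 2
        _ = _ := by simp
    have h3 : ∀ n, fourierCoeff g n = (fourier n (h : AddCircle (2 * Real.pi)) - 1) *
        fourierCoeff f n := fun n => fourierCoeff_translate_sub f h n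
    simp_rw [h3, norm_mul] at h1
    have hpos : 0 < |h| ^ 2 := by positivity
    simp_rw [norm_div, Complex.norm_real, Real.norm_eq_abs, div_pow, div_mul_eq_mul_div, ← mul_pow]
    rw [← Finset.sum_div, div_le_iff₀ hpos, ← mul_pow]
    exact h1.trans h2
  have lim : Tendsto (fun h : ℝ => ∑ n ∈ S,
      ‖(fourier n (h : AddCircle (2 * Real.pi)) - 1) / (h : ℂ)‖ ^ 2 * ‖fourierCoeff f n‖ ^ 2)
      (𝓝[≠] 0) (𝓝 (∑ n ∈ S, (n : ℝ) ^ 2 * ‖fourierCoeff f n‖ ^ 2)) := by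
    refine tendsto_finsetSum _ fun n _ => ?_
    have := ((tendsto_fourier_sub_one_div n).norm.pow 2).mul_const (‖fourierCoeff f n‖ ^ 2)
    simpa using this
  exact le_of_tendsto lim (eventually_mem_nhdsWithin.mono fun h hh => key h hh)

theorem integral_re_mul_fourier {T : ℝ} [Fact (0 < T)] (z : ℂ) {k : ℤ} (hk : k ≠ 0) :
    ∫ x : AddCircle T, (z * fourier k x).re ∂haarAddCircle = 0 := by
  have h0 : ∫ x : AddCircle T, fourier k x ∂haarAddCircle = 0 := by
    have := congr_fun (fourierCoeff_fourier (T := T) k) 0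
    simpa [fourierCoeff, hk.symm, -fourier_apply, fourier_zero] using this
  have h1 : ∫ x : AddCircle T, (z * fourier k x).re ∂haarAddCircle
      = (∫ x : AddCircle T, z * fourier k x ∂haarAddCircle).re :=
    integral_re (𝕜 := ℂ) (f := fun x : AddCircle T => z * fourier k x)
      (integrable_of_continuous_addCircle (by fun_prop))
  rw [h1, integral_const_mul, h0]
  simp

/-- The first Fourier coefficients of an `r`-Lipschitz loop, tested against the speed of the
ellipse that they describe. -/
theorem sq_add_sq_fourierCoeff_le
    (hf : ∀ x (h : ℝ), ‖f (x + h) - f x‖ ≤ r * |h|) :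
    ‖fourierCoeff f 1‖ ^ 2 + ‖fourierCoeff f (-1)‖ ^ 2 ≤
      r * ∫ x : AddCircle (2 * Real.pi),
        ‖fourierCoeff f 1 * fourier 1 x - fourierCoeff f (-1) * fourier (-1) x‖ ∂haarAddCircle := by
  set a := fourierCoeff f 1
  set b := fourierCoeff f (-1)
  let g : AddCircle (2 * Real.pi) → ℂ := fun x => a * fourier 1 x - b * fourier (-1) x
  have hgc : Continuous g := by fun_prop
  have key : ∀ h : ℝ, h ≠ 0 →
      ‖starRingEnd ℂ a * a * ((fourier 1 (h : AddCircle (2 * Real.pi)) - 1) / (h : ℂ)) -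
        starRingEnd ℂ b * b * ((fourier (-1) (h : AddCircle (2 * Real.pi)) - 1) / (h : ℂ))‖ ≤
        r * ∫ x, ‖g x‖ ∂haarAddCircle := by
    intro h hh
    let F : AddCircle (2 * Real.pi) → ℂ := fun x => f (x + h) - f x
    have hF : Continuous F := by fun_prop
    have e1 : ∫ x, starRingEnd ℂ (g x) * F x ∂haarAddCircle =
        starRingEnd ℂ a * fourierCoeff F 1 - starRingEnd ℂ b * fourierCoeff F (-1) := by
      unfold fourierCoeff
      rw [← integral_const_mul, ← integral_const_mul, ← integral_sub]
      · congr 1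
        ext x
        simp only [g, map_sub, map_mul, ← fourier_neg, smul_eq_mul]
        ring
      · exact integrable_of_continuous_addCircle (by fun_prop)
      · exact integrable_of_continuous_addCircle (by fun_prop)
    have e2 : ‖∫ x, starRingEnd ℂ (g x) * F x ∂haarAddCircle‖ ≤
        ∫ x, ‖g x‖ * (r * |h|) ∂haarAddCircle := by
      refine norm_integral_le_of_norm_le (integrable_of_continuous_addCircle (by fun_prop))
        (ae_of_all _ fun x => ?_)
      rw [norm_mul, RCLike.norm_conj]
      exact mul_le_mul_of_nonneg_left (hf x h) (norm_nonneg _)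
    rw [e1, integral_mul_const, fourierCoeff_translate_sub, fourierCoeff_translate_sub] at e2
    have hpos : 0 < |h| := abs_pos.2 hh
    rw [show starRingEnd ℂ a * a * ((fourier 1 (h : AddCircle (2 * Real.pi)) - 1) / (h : ℂ)) -
        starRingEnd ℂ b * b * ((fourier (-1) (h : AddCircle (2 * Real.pi)) - 1) / (h : ℂ)) =
        (starRingEnd ℂ a * ((fourier 1 (h : AddCircle (2 * Real.pi)) - 1) * a) -
        starRingEnd ℂ b * ((fourier (-1) (h : AddCircle (2 * Real.pi)) - 1) * b)) / (h : ℂ) by ring,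
      norm_div, Complex.norm_real, Real.norm_eq_abs, div_le_iff₀ hpos]
    calc _ ≤ _ := e2
      _ = _ := by ring
  have lim := ((((tendsto_fourier_sub_one_div 1).const_mul (starRingEnd ℂ a * a)).sub
    ((tendsto_fourier_sub_one_div (-1)).const_mul (starRingEnd ℂ b * b))).norm)
  have := le_of_tendsto lim (eventually_mem_nhdsWithin.mono fun h hh => key h hh)
  refine le_trans (le_of_eq ?_) this
  have e : starRingEnd ℂ a * a * (Complex.I * ((1 : ℤ) : ℂ)) -
      starRingEnd ℂ b * b * (Complex.I * ((-1 : ℤ) : ℂ)) =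
      ((‖a‖ ^ 2 + ‖b‖ ^ 2 : ℝ) : ℂ) * Complex.I := by
    rw [Complex.conj_mul', Complex.conj_mul']
    push_cast
    ring
  rw [e, norm_mul, Complex.norm_I, mul_one, Complex.norm_real, Real.norm_of_nonneg (by positivity)]

/-- With `v = s²u` this is `√(1 + u) ≤ 1 + u/2 - u²/16` for `|u| ≤ 1`. The quadratic term is what
makes Jensen's inequality for the ellipse speed quantitative. -/
theorem mul_norm_le_of_sq {s t v : ℝ} (hs : 0 < s) (hv : |v| ≤ s ^ 2) (h : t ^ 2 = s ^ 2 + v) :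
    s * t ≤ s ^ 2 + v / 2 - v ^ 2 / (16 * s ^ 2) := by
  obtain ⟨u, rfl⟩ : ∃ u, v = s ^ 2 * u := ⟨v / s ^ 2, by field_simp⟩
  have hs2 : 0 < s ^ 2 := by positivity
  rw [abs_mul, abs_of_pos hs2] at hv
  have hu : |u| ≤ 1 := by nlinarith
  obtain ⟨hu1, hu2⟩ := abs_le.1 hu
  have e : s ^ 2 + s ^ 2 * u / 2 - (s ^ 2 * u) ^ 2 / (16 * s ^ 2) =
      s ^ 2 * (1 + u / 2 - u ^ 2 / 16) := by field_simp
  rw [e]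
  have h1 : t ^ 2 = s ^ 2 * (1 + u) := by rw [h]; ring
  have hp : 0 ≤ 1 + u / 2 - u ^ 2 / 16 := by nlinarith
  have h2 : t ^ 2 ≤ (s * (1 + u / 2 - u ^ 2 / 16)) ^ 2 := by
    rw [h1, mul_pow]
    refine mul_le_mul_of_nonneg_left ?_ hs2.le
    nlinarith [mul_nonneg (sq_nonneg u) (by linarith : 0 ≤ 2 - u), sq_nonneg (u ^ 2)]
  have h3 := abs_le_of_sq_le_sq h2 (mul_nonneg hs.le hp)
  nlinarith [le_abs_self t]

/-- The squared speed is `s² + v` with `v` a pure second harmonic, so `v` has mean `0` and `v²` has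
mean `2(|a||b|)²`. Integrating `mul_norm_le_of_sq` gives the gain, with `2/16 = 1/8`. -/
theorem mul_integral_norm_ellipse_le {T : ℝ} [Fact (0 < T)] (a b : ℂ) {s : ℝ} (hs : 0 < s)
    (hab : s ^ 2 = ‖a‖ ^ 2 + ‖b‖ ^ 2) :
    s * ∫ x : AddCircle T, ‖a * fourier 1 x - b * fourier (-1) x‖ ∂haarAddCircle ≤
      s ^ 2 - (‖a‖ * ‖b‖) ^ 2 / (8 * s ^ 2) := by
  let z : ℂ := -(a * starRingEnd ℂ b)
  have hz : ‖z‖ = ‖a‖ * ‖b‖ := by simp [z]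
  have hw : ∀ x : AddCircle T, ‖fourier 2 x‖ = 1 := fun x => Circle.norm_coe _
  let v : AddCircle T → ℝ := fun x => 2 * (z * fourier 2 x).re
  have hvc : Continuous v := by fun_prop
  have h1 : ∀ x : AddCircle T,
      ‖a * fourier 1 x - b * fourier (-1) x‖ ^ 2 = s ^ 2 + v x := by
    intro x
    have hn : ∀ n : ℤ, ‖fourier n x‖ = 1 := fun n => Circle.norm_coe _
    have e2 : fourier 2 x = fourier 1 x * fourier 1 x := by
      rw [← fourier_add]; norm_num
    rw [← Complex.normSq_eq_norm_sq, Complex.normSq_sub, Complex.normSq_eq_norm_sq,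
      Complex.normSq_eq_norm_sq, norm_mul, norm_mul, hn, hn, hab]
    simp only [v, z, map_mul, e2, ← fourier_neg, neg_neg]
    rw [show -(a * starRingEnd ℂ b) * (fourier 1 x * fourier 1 x) =
      -(a * fourier 1 x * (starRingEnd ℂ b * fourier 1 x)) by ring, Complex.neg_re]
    ring
  have hvb : ∀ x, |v x| ≤ s ^ 2 := by
    intro x
    have := Complex.abs_re_le_norm (z * fourier 2 x)
    rw [norm_mul, hw, mul_one, hz] at this
    simp only [v, abs_mul, abs_two]
    nlinarith [sq_nonneg (‖a‖ - ‖b‖)]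
  have hv0 : ∫ x, v x ∂haarAddCircle = 0 := by
    simp only [v]
    rw [integral_const_mul, integral_re_mul_fourier _ two_ne_zero, mul_zero]
  have hv2 : ∫ x, v x ^ 2 ∂haarAddCircle = 2 * (‖a‖ * ‖b‖) ^ 2 := by
    have e : ∀ x, v x ^ 2 = 2 * (‖a‖ * ‖b‖) ^ 2 + 2 * (z ^ 2 * fourier 4 x).re := by
      intro x
      have e4 : z ^ 2 * fourier 4 x = (z * fourier 2 x) ^ 2 := by
        rw [mul_pow, sq (fourier 2 x), ← fourier_add]; norm_num
      have hn : ‖z * fourier 2 x‖ ^ 2 = (‖a‖ * ‖b‖) ^ 2 := by rw [norm_mul, hw, mul_one, hz]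
      rw [← hn, e4, ← Complex.normSq_eq_norm_sq, Complex.normSq_apply]
      simp only [v, sq, Complex.mul_re (z * fourier 2 x)]
      ring
    simp_rw [e]
    rw [integral_add (integrable_const _) (integrable_of_continuous_addCircle (by fun_prop)),
      integral_const_mul 2 (fun x => (z ^ 2 * fourier 4 x).re),
      integral_re_mul_fourier _ four_ne_zero]
    simp
  rw [← integral_const_mul]
  calc _ ≤ ∫ x, (s ^ 2 + v x / 2 - v x ^ 2 / (16 * s ^ 2)) ∂haarAddCircle := by
        refine integral_mono (integrable_of_continuous_addCircle (by fun_prop))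
          (integrable_of_continuous_addCircle (by fun_prop)) fun x => ?_
        exact mul_norm_le_of_sq hs (hvb x) (h1 x)
    _ = _ := by
        rw [integral_sub (integrable_of_continuous_addCircle (by fun_prop))
          (integrable_of_continuous_addCircle (by fun_prop)),
          integral_add (integrable_const _) (integrable_of_continuous_addCircle (by fun_prop)),
          integral_div, integral_div, hv0, hv2]
        simp
        field_simp
        ring

/-- The isoperimetric-type deficit controls the higher Fourier modes. -/
theorem sum_sq_sub_one_mul_sq_fourierCoeff_le
    (hf : ∀ x (h : ℝ), ‖f (x + h) - f x‖ ≤ r * |h|) (h0 : fourierCoeff f 0 = 0) (S : Finset ℤ) :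
    ∑ n ∈ S, ((n : ℝ) ^ 2 - 1) * ‖fourierCoeff f n‖ ^ 2 ≤
      r ^ 2 - ∫ x, ‖f x‖ ^ 2 ∂haarAddCircle := by
  have key : ∀ T : Finset ℤ, S ⊆ T → ∑ n ∈ T, ‖fourierCoeff f n‖ ^ 2 ≤
      r ^ 2 - ∑ n ∈ S, ((n : ℝ) ^ 2 - 1) * ‖fourierCoeff f n‖ ^ 2 := by
    intro T hST
    have h1 : ∑ n ∈ S, ((n : ℝ) ^ 2 - 1) * ‖fourierCoeff f n‖ ^ 2 ≤
        ∑ n ∈ T, ((n : ℝ) ^ 2 - 1) * ‖fourierCoeff f n‖ ^ 2 := by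
      refine Finset.sum_le_sum_of_subset_of_nonneg hST fun n _ _ => ?_
      rcases eq_or_ne n 0 with rfl | hn
      · simp [h0]
      · have : (1 : ℝ) ≤ (n : ℝ) ^ 2 := by
          have : (1 : ℤ) ≤ n ^ 2 := by nlinarith [Int.one_le_abs hn, sq_abs n]
          exact_mod_cast this
        exact mul_nonneg (by linarith) (sq_nonneg _)
    have h2 := sum_sq_mul_sq_fourierCoeff_le hf T
    simp_rw [sub_mul, one_mul, Finset.sum_sub_distrib] at h1 ⊢
    linarith
  have := le_of_tendsto (hasSum_sq_fourierCoeff_continuousMap f)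
    ((eventually_ge_atTop S).mono key)
  linarith

theorem sum_norm_fourierCoeff_le
    (hf : ∀ x (h : ℝ), ‖f (x + h) - f x‖ ≤ r * |h|) (h0 : fourierCoeff f 0 = 0) (S : Finset ℤ)
    (h1 : 1 ∉ S) (h2 : -1 ∉ S) :
    ∑ n ∈ S, ‖fourierCoeff f n‖ ≤
      √((∑' n : ℤ, 2 / (n : ℝ) ^ 2) * (r ^ 2 - ∫ x, ‖f x‖ ^ 2 ∂haarAddCircle)) := by
  have hsum : Summable fun n : ℤ => 2 / (n : ℝ) ^ 2 := by
    simpa [div_eq_mul_inv] using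
      ((Real.summable_one_div_int_pow (p := 2)).2 one_lt_two).mul_left 2
  apply Real.le_sqrt_of_sq_le
  -- Cauchy-Schwarz with weights `2/n²` and `n²/2`. The second is at most `n² - 1` once `|n| ≥ 2`.
  -- At `n = 0` the quotient `2/0` is `0`, which is harmless because the coefficient vanishes.
  have hcs := Finset.sum_sq_le_sum_mul_sum_of_sq_le_mul S
    (r := fun n => ‖fourierCoeff f n‖) (f := fun n : ℤ => 2 / (n : ℝ) ^ 2)
    (g := fun n : ℤ => (n : ℝ) ^ 2 / 2 * ‖fourierCoeff f n‖ ^ 2)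
    (fun n _ => by positivity) (fun n _ => by positivity) (fun n _ => by
      rcases eq_or_ne n 0 with rfl | hn
      · simp [h0]
      · have : (n : ℝ) ≠ 0 := by exact_mod_cast hn
        exact le_of_eq (by field_simp))
  refine hcs.trans (mul_le_mul (hsum.sum_le_tsum S fun n _ => by positivity) ?_
    (Finset.sum_nonneg fun n _ => by positivity) (tsum_nonneg fun n => by positivity))
  refine le_trans (Finset.sum_le_sum fun n hn => ?_) (sum_sq_sub_one_mul_sq_fourierCoeff_le hf h0 S)
  rcases eq_or_ne n 0 with rfl | hn0
  · simp [h0]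
  · refine mul_le_mul_of_nonneg_right ?_ (sq_nonneg _)
    have : (2 : ℤ) ≤ n ^ 2 := by
      have h3 : n ≠ 1 := fun h => h1 (h ▸ hn)
      have h4 : n ≠ -1 := fun h => h2 (h ▸ hn)
      have : 2 ≤ |n| := by
        rcases abs_cases n with ⟨h, _⟩ | ⟨h, _⟩ <;> omega
      nlinarith [sq_abs n]
    have : (2 : ℝ) ≤ (n : ℝ) ^ 2 := by exact_mod_cast this
    linarith

/-- The modes `|n| ≥ 2` carry at most `δ` of the mean square, since `n² - 1 ≥ 1` there, and the mean
square is itself `r² - δ`; hence the factor `2`. -/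
theorem sq_le_sq_add_sq_fourierCoeff_add
    (hf : ∀ x (h : ℝ), ‖f (x + h) - f x‖ ≤ r * |h|) (h0 : fourierCoeff f 0 = 0) :
    r ^ 2 ≤ ‖fourierCoeff f 1‖ ^ 2 + ‖fourierCoeff f (-1)‖ ^ 2 +
      2 * (r ^ 2 - ∫ x, ‖f x‖ ^ 2 ∂haarAddCircle) := by
  have key : ∀ T : Finset ℤ, {1, -1} ⊆ T → ∑ n ∈ T, ‖fourierCoeff f n‖ ^ 2 ≤
      ‖fourierCoeff f 1‖ ^ 2 + ‖fourierCoeff f (-1)‖ ^ 2 +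
        (r ^ 2 - ∫ x, ‖f x‖ ^ 2 ∂haarAddCircle) := by
    intro T hT
    rw [← Finset.sum_sdiff hT, Finset.sum_pair (by norm_num), add_comm]
    refine add_le_add_right (le_trans (Finset.sum_le_sum fun n hn => ?_)
      (sum_sq_sub_one_mul_sq_fourierCoeff_le hf h0 (T \ {1, -1}))) _
    rcases eq_or_ne n 0 with rfl | hn0
    · simp [h0]
    · simp only [Finset.mem_sdiff, Finset.mem_insert, Finset.mem_singleton, not_or] at hn
      have : (2 : ℤ) ≤ n ^ 2 := by
        have : 2 ≤ |n| := by
          rcases abs_cases n with ⟨h, _⟩ | ⟨h, _⟩ <;> omega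
        nlinarith [sq_abs n]
      have : (2 : ℝ) ≤ (n : ℝ) ^ 2 := by exact_mod_cast this
      nlinarith [sq_nonneg ‖fourierCoeff f n‖]
  have := le_of_tendsto (hasSum_sq_fourierCoeff_continuousMap f)
    ((eventually_ge_atTop {1, -1}).mono key)
  linarith

/-- The uniform bound on finite sums of coefficient norms makes the Fourier series absolutely
summable, hence pointwise convergent to `f`, and then bounds its tail. -/
theorem norm_sub_first_modes_le
    (hf : ∀ x (h : ℝ), ‖f (x + h) - f x‖ ≤ r * |h|) (h0 : fourierCoeff f 0 = 0)
    (x : AddCircle (2 * Real.pi)) :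
    ‖f x - (fourierCoeff f 1 * fourier 1 x + fourierCoeff f (-1) * fourier (-1) x)‖ ≤
      √((∑' n : ℤ, 2 / (n : ℝ) ^ 2) * (r ^ 2 - ∫ x, ‖f x‖ ^ 2 ∂haarAddCircle)) := by
  have hsum : Summable (fourierCoeff f) := by
    refine .of_norm (summable_of_sum_le (fun n => norm_nonneg _)
      (c := √((∑' n : ℤ, 2 / (n : ℝ) ^ 2) * (r ^ 2 - ∫ x, ‖f x‖ ^ 2 ∂haarAddCircle)) +
        ∑ n ∈ {1, -1}, ‖fourierCoeff f n‖) fun S => ?_)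
    calc _ ≤ ∑ n ∈ S ∪ {1, -1}, ‖fourierCoeff f n‖ :=
          Finset.sum_le_sum_of_subset_of_nonneg Finset.subset_union_left fun _ _ _ => norm_nonneg _
      _ = ∑ n ∈ (S ∪ {1, -1}) \ {1, -1}, ‖fourierCoeff f n‖ + ∑ n ∈ {1, -1}, ‖fourierCoeff f n‖ :=
          (Finset.sum_sdiff Finset.subset_union_right).symm
      _ ≤ _ := add_le_add_left (sum_norm_fourierCoeff_le hf h0 _ (by simp) (by simp)) _
  have hlim := (has_pointwise_sum_fourier_series_of_summable hsum x).sub_const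
    (fourierCoeff f 1 * fourier 1 x + fourierCoeff f (-1) * fourier (-1) x)
  refine le_of_tendsto hlim.norm ((eventually_ge_atTop {1, -1}).mono fun T hT => ?_)
  rw [← Finset.sum_sdiff hT, Finset.sum_pair (by norm_num)]
  simp only [smul_eq_mul]
  rw [add_sub_cancel_right]
  refine (norm_sum_le _ _).trans (le_trans (Finset.sum_le_sum fun n _ => ?_)
    (sum_norm_fourierCoeff_le hf h0 (T \ {1, -1}) (by simp) (by simp)))
  rw [norm_mul, show ‖fourier n x‖ = 1 from Circle.norm_coe _, mul_one]

/-- As `x` runs round the circle, `c e^{±ix}` takes every argument. Matching that of `w` leaves only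
the difference of the moduli. -/
theorem exists_fourier_mul_near (c w : ℂ) (n : ℤ) (hn : n = 1 ∨ n = -1) :
    ∃ x : AddCircle (2 * Real.pi), ‖c * fourier n x - w‖ ≤ |‖c‖ - ‖w‖| := by
  have key : ∀ t : ℝ, fourier n ((n * t : ℝ) : AddCircle (2 * Real.pi)) =
      Complex.exp (t * Complex.I) := by
    intro t
    have hn2 : (n : ℂ) * n = 1 := by rcases hn with rfl | rfl <;> norm_num
    have : (Real.pi : ℂ) ≠ 0 := by exact_mod_cast Real.pi_ne_zero
    rw [fourier_coe_apply]
    congr 1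
    push_cast
    field_simp
    linear_combination (t : ℂ) * hn2
  refine ⟨((n * (w.arg - c.arg) : ℝ) : AddCircle (2 * Real.pi)), le_of_eq ?_⟩
  rw [key]
  have e : c * Complex.exp (((w.arg - c.arg : ℝ) : ℂ) * Complex.I) - w =
      ((‖c‖ - ‖w‖ : ℝ) : ℂ) * Complex.exp (w.arg * Complex.I) := by
    have hc := Complex.norm_mul_exp_arg_mul_I c
    have hw := Complex.norm_mul_exp_arg_mul_I w
    have he : Complex.exp (c.arg * Complex.I) *
        Complex.exp (((w.arg - c.arg : ℝ) : ℂ) * Complex.I) = Complex.exp (w.arg * Complex.I) := by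
      rw [← Complex.exp_add]
      push_cast
      ring_nf
    push_cast at he ⊢
    linear_combination -Complex.exp ((w.arg - c.arg) * Complex.I) * hc + hw + ‖c‖ * he
  rw [e, norm_mul, Complex.norm_exp_ofReal_mul_I, mul_one, Complex.norm_real, Real.norm_eq_abs]

/-- Here `h2` bounds `r (a b)²` by `8s⁴(r - s)`. Since `r² - rs ≤ r² - s² ≤ 2δ` and `s ≤ r`, this
yields `(a b)² ≤ 16 s²δ`; the larger coefficient satisfies `b² ≥ s²/2`, whence `32`. -/
theorem sq_fourierCoeff_smaller_le {a b r s δ : ℝ} (ha : 0 ≤ a) (hba : a ≤ b)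
    (hs : 0 < s) (hsr : s ≤ r) (hab : s ^ 2 = a ^ 2 + b ^ 2)
    (h1 : r ^ 2 ≤ s ^ 2 + 2 * δ) (h2 : s ^ 3 ≤ r * (s ^ 2 - (a * b) ^ 2 / (8 * s ^ 2))) :
    a ^ 2 ≤ 32 * δ := by
  have hr : 0 < r := hs.trans_le hsr
  have e1 : r * (a * b) ^ 2 ≤ 8 * s ^ 4 * (r - s) := by
    have : r * (s ^ 2 - (a * b) ^ 2 / (8 * s ^ 2)) = r * s ^ 2 - r * (a * b) ^ 2 / (8 * s ^ 2) := by
      ring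
    rw [this] at h2
    have h3 : r * (a * b) ^ 2 / (8 * s ^ 2) ≤ r * s ^ 2 - s ^ 3 := by linarith
    rw [div_le_iff₀ (by positivity)] at h3
    linarith
  have e2 : r ^ 2 * (a * b) ^ 2 ≤ 16 * s ^ 4 * δ := by
    have h4 : r ^ 2 * (a * b) ^ 2 ≤ 8 * s ^ 4 * (r ^ 2 - s * r) := by nlinarith
    have h5 : 8 * s ^ 4 * (r ^ 2 - s * r) ≤ 8 * s ^ 4 * (2 * δ) :=
      mul_le_mul_of_nonneg_left (by nlinarith) (by positivity)
    linarith
  have e3 : s ^ 2 * (a * b) ^ 2 ≤ s ^ 2 * (16 * s ^ 2 * δ) := by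
    have : s ^ 2 * (a * b) ^ 2 ≤ r ^ 2 * (a * b) ^ 2 :=
      mul_le_mul_of_nonneg_right (by nlinarith) (sq_nonneg _)
    linarith
  have e4 : (a * b) ^ 2 ≤ 16 * s ^ 2 * δ := le_of_mul_le_mul_left e3 (by positivity)
  have e5 : s ^ 2 * a ^ 2 ≤ s ^ 2 * (32 * δ) := by
    have : s ^ 2 * a ^ 2 ≤ 2 * b ^ 2 * a ^ 2 :=
      mul_le_mul_of_nonneg_right (by nlinarith) (sq_nonneg _)
    nlinarith
  exact le_of_mul_le_mul_left e5 (by positivity)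

/-- Stability of Wirtinger's inequality for loops with Lipschitz constant `r`: if the mean square
of a centred loop is almost `r ^ 2`, then the loop is uniformly close to a circle of radius `r`. -/
theorem exists_lipschitz_loop_near_sphere :
    ∃ K : ℝ, 0 < K ∧ ∀ (r : ℝ) (f : C(AddCircle (2 * Real.pi), ℂ)), 0 ≤ r →
      (∀ x (h : ℝ), ‖f (x + h) - f x‖ ≤ r * |h|) → fourierCoeff f 0 = 0 →
      0 ≤ r ^ 2 - ∫ x, ‖f x‖ ^ 2 ∂haarAddCircle ∧
      (∀ x, ‖f x‖ ≤ r + K * √(r ^ 2 - ∫ x, ‖f x‖ ^ 2 ∂haarAddCircle)) ∧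
      ∀ w : ℂ, ‖w‖ = r → ∃ x, ‖f x - w‖ ≤ K * √(r ^ 2 - ∫ x, ‖f x‖ ^ 2 ∂haarAddCircle) := by
  set K₀ : ℝ := ∑' n : ℤ, 2 / (n : ℝ) ^ 2
  -- The three terms pay for the modes `|n| ≥ 2`, for the smaller first mode `d`, and for the radius
  -- error of the larger one `c`: `(r - |c|)² ≤ r² - |c|² ≤ (2 + 32)δ`.
  refine ⟨√K₀ + √32 + √34, by positivity, fun r f hr hf h0 => ?_⟩
  have hK₀ : 0 ≤ K₀ := tsum_nonneg fun n => by positivity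
  have hδ := sum_sq_sub_one_mul_sq_fourierCoeff_le hf h0 ∅
  have hr2 := sq_le_sq_add_sq_fourierCoeff_add hf h0
  have hmodes := norm_sub_first_modes_le hf h0
  set δ := r ^ 2 - ∫ x, ‖f x‖ ^ 2 ∂haarAddCircle
  rw [Finset.sum_empty] at hδ
  have hsq : ‖fourierCoeff f 1‖ ^ 2 + ‖fourierCoeff f (-1)‖ ^ 2 ≤ r ^ 2 := by
    have := sum_sq_mul_sq_fourierCoeff_le hf {1, -1}
    rw [Finset.sum_pair (by norm_num)] at this
    simpa using this
  obtain ⟨n, m, hn, hsplit, hm, hM⟩ : ∃ n m : ℤ, (n = 1 ∨ n = -1) ∧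
      (∀ x, fourierCoeff f 1 * fourier 1 x + fourierCoeff f (-1) * fourier (-1) x =
        fourierCoeff f n * fourier n x + fourierCoeff f m * fourier m x) ∧
      ‖fourierCoeff f m‖ ^ 2 ≤ 32 * δ ∧
      ‖fourierCoeff f 1‖ ^ 2 + ‖fourierCoeff f (-1)‖ ^ 2 =
        ‖fourierCoeff f n‖ ^ 2 + ‖fourierCoeff f m‖ ^ 2 := by
    have hspeed := sq_add_sq_fourierCoeff_le hf
    set a := fourierCoeff f 1
    set b := fourierCoeff f (-1)
    have hmin : ∀ p q : ℝ, 0 ≤ p → p ≤ q → p ^ 2 + q ^ 2 = ‖a‖ ^ 2 + ‖b‖ ^ 2 →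
        p * q = ‖a‖ * ‖b‖ → p ^ 2 ≤ 32 * δ := by
      intro p q hp hpq hpq2 hpqm
      rcases eq_or_lt_of_le (show 0 ≤ ‖a‖ ^ 2 + ‖b‖ ^ 2 by positivity) with hz | hpos
      · nlinarith [sq_nonneg q]
      · have hs2 : √(‖a‖ ^ 2 + ‖b‖ ^ 2) ^ 2 = ‖a‖ ^ 2 + ‖b‖ ^ 2 := Real.sq_sqrt hpos.le
        have hs : 0 < √(‖a‖ ^ 2 + ‖b‖ ^ 2) := Real.sqrt_pos.2 hpos
        set s := √(‖a‖ ^ 2 + ‖b‖ ^ 2)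
        have hell := mul_integral_norm_ellipse_le (T := 2 * Real.pi) a b hs hs2
        refine sq_fourierCoeff_smaller_le hp hpq hs
          (abs_le_of_sq_le_sq' (by rw [hs2]; exact hsq) hr).2 (by rw [hs2, hpq2])
          (by rw [hs2]; exact hr2) ?_
        rw [hpqm]
        rw [← hs2] at hspeed
        nlinarith [mul_le_mul_of_nonneg_left hspeed hs.le, mul_le_mul_of_nonneg_left hell hr]
    rcases le_total ‖b‖ ‖a‖ with hle | hle
    · exact ⟨1, -1, Or.inl rfl, fun x => rfl,
        hmin _ _ (norm_nonneg _) hle (add_comm _ _) (mul_comm _ _), rfl⟩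
    · exact ⟨-1, 1, Or.inr rfl, fun x => add_comm _ _,
        hmin _ _ (norm_nonneg _) hle rfl rfl, add_comm _ _⟩
  set c := fourierCoeff f n
  set d := fourierCoeff f m
  have hd : ‖d‖ ≤ √32 * √δ := by
    rw [← Real.sqrt_mul (by norm_num)]
    exact Real.le_sqrt_of_sq_le hm
  have hnear : ∀ x, ‖f x - c * fourier n x‖ ≤ (√K₀ + √32) * √δ := by
    intro x
    have h1 := hmodes x
    rw [hsplit x, Real.sqrt_mul hK₀] at h1
    have h2 : ‖d * fourier m x‖ = ‖d‖ := by
      rw [norm_mul, show ‖fourier m x‖ = 1 from Circle.norm_coe _, mul_one]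
    calc ‖f x - c * fourier n x‖ = ‖f x - (c * fourier n x + d * fourier m x) + d * fourier m x‖ := by
          congr 1; ring
      _ ≤ _ := norm_add_le _ _
      _ ≤ _ := by rw [h2, add_mul]; exact add_le_add h1 hd
  have hcr : ‖c‖ ≤ r := (abs_le_of_sq_le_sq' (by nlinarith [sq_nonneg ‖d‖]) hr).2
  have hcr' : r - ‖c‖ ≤ √34 * √δ := by
    rw [← Real.sqrt_mul (by norm_num)]
    apply Real.le_sqrt_of_sq_le
    nlinarith [norm_nonneg c]
  refine ⟨hδ, fun x => ?_, fun w hw => ?_⟩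
  · have h1 : ‖c * fourier n x‖ = ‖c‖ := by
      rw [norm_mul, show ‖fourier n x‖ = 1 from Circle.norm_coe _, mul_one]
    have h2 := norm_add_le (f x - c * fourier n x) (c * fourier n x)
    rw [sub_add_cancel, h1] at h2
    nlinarith [hnear x, mul_nonneg (Real.sqrt_nonneg 34) (Real.sqrt_nonneg δ)]
  · obtain ⟨x, hx⟩ := exists_fourier_mul_near c w n hn
    refine ⟨x, ?_⟩
    have h1 := norm_add_le (f x - c * fourier n x) (c * fourier n x - w)
    rw [sub_add_sub_cancel] at h1
    rw [hw, abs_of_nonpos (by linarith)] at hx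
    linarith [hnear x]

end FourierStability

/-! ### From closeness of boundaries to Hausdorff distances, by convexity -/

section ConvexHausdorff

open Metric

variable {V : Type*} [NormedAddCommGroup V] [InnerProductSpace ℝ V]

theorem IsPreconnected.exists_mem_frontier {X : Type*} [TopologicalSpace X] {s E : Set X}
    (hs : IsPreconnected s) {x y : X} (hx : x ∈ s) (hxE : x ∈ E) (hy : y ∈ s) (hyE : y ∉ E) :
    ∃ z ∈ s, z ∈ frontier E := by
  by_contra! hcon
  have hcl : ∀ z ∈ s, z ∈ closure E → z ∈ interior E := fun z hz hzc => by
    by_contra hzi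
    exact hcon z hz ⟨hzc, hzi⟩
  obtain ⟨z, -, hz1, hz2⟩ := hs (interior E) (closure E)ᶜ isOpen_interior
    isClosed_closure.isOpen_compl
    (fun z hz => (em (z ∈ closure E)).imp (hcl z hz) id)
    ⟨x, hx, hcl x hx (subset_closure hxE)⟩
    ⟨y, hy, fun h => hyE (interior_subset (hcl y hy h))⟩
  exact hz2 (interior_subset_closure hz1)

/-- If a set lies in the `ε`-neighbourhood of an open convex set `E`, then the complement of `E`
lies in every larger neighbourhood of the complement of that set. -/
theorem exists_notMem_dist_le_of_convex [CompleteSpace V] {E F : Set V} (hE : IsOpen E)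
    (hc : Convex ℝ E) (hne : E.Nonempty) {ε η : ℝ} (hε : 0 ≤ ε) (hη : 0 < η)
    (h : ∀ y ∈ F, ∃ e ∈ closure E, dist y e ≤ ε) {x : V} (hx : x ∉ E) :
    ∃ y, y ∉ F ∧ dist x y ≤ ε + η := by
  obtain ⟨f, hf⟩ := geometric_hahn_banach_open_point hc hE hx
  set v := (InnerProductSpace.toDual ℝ V).symm f
  have hfv : ∀ z, f z = inner ℝ v z := fun z => by simp [v]
  have hv : v ≠ 0 := by
    rintro h0
    obtain ⟨a, ha⟩ := hne
    have := hf a ha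
    simp [hfv, h0] at this
  have hvn : 0 < ‖v‖ := norm_pos_iff.2 hv
  -- Moving `x` by `ε + η` along the outer normal of a separating half-space takes it farther than
  -- `ε` from `E`, hence out of `F`.
  refine ⟨x + ((ε + η) / ‖v‖) • v, fun hy => ?_, ?_⟩
  · obtain ⟨e, he, hye⟩ := h _ hy
    have h1 : f e ≤ f x :=
      closure_minimal (fun a ha => (hf a ha).le) (isClosed_le f.continuous continuous_const) he
    have h2 : f (x + ((ε + η) / ‖v‖) • v) = f x + (ε + η) * ‖v‖ := by
      rw [map_add, map_smul, hfv v, real_inner_self_eq_norm_sq, smul_eq_mul]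
      field_simp
    have h3 : f (x + ((ε + η) / ‖v‖) • v) - f e ≤ ‖v‖ * ε := by
      rw [← map_sub, hfv]
      exact (real_inner_le_norm _ _).trans
        (mul_le_mul_of_nonneg_left (by rwa [← dist_eq_norm]) hvn.le)
    nlinarith
  · rw [dist_self_add_right, norm_smul, Real.norm_of_nonneg (by positivity)]
    field_simp
    exact le_rfl

/-- The ray from a point of `E` away from `x₀` must leave the bounded set, and the boundary point it
meets is at least as far from `x₀`. -/
theorem closure_subset_closedBall_of_frontier {E : Set V}
    (hb : Bornology.IsBounded E) {x₀ : V} {R : ℝ} (hR : 0 ≤ R)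
    (h : ∀ x ∈ frontier E, dist x x₀ ≤ R) : closure E ⊆ closedBall x₀ R := by
  refine closure_minimal (fun x hx => ?_) isClosed_closedBall
  rcases eq_or_ne x x₀ with rfl | hne
  · exact mem_closedBall_self hR
  let p : ℝ → V := fun t => x + t • (x - x₀)
  have hpre : IsPreconnected (p '' Set.Ici 0) :=
    isPreconnected_Ici.image p (by fun_prop)
  have hpos : 0 < ‖x - x₀‖ := norm_pos_iff.2 (sub_ne_zero.2 hne)
  have hp : ∀ t, 0 ≤ t → dist (p t) x₀ = (1 + t) * ‖x - x₀‖ := by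
    intro t ht
    have : p t - x₀ = (1 + t) • (x - x₀) := by simp only [p]; module
    rw [dist_eq_norm, this, norm_smul, Real.norm_of_nonneg (by linarith)]
  obtain ⟨C, hC⟩ := hb.subset_closedBall x₀
  have hC0 : 0 ≤ C := dist_nonneg.trans (hC hx)
  obtain ⟨_, ⟨t, ht, rfl⟩, hy⟩ := hpre.exists_mem_frontier (E := E) (x := x)
    ⟨0, by simp, by simp [p]⟩ hx (y := p ((C + 1) / ‖x - x₀‖))
    ⟨_, Set.mem_Ici.2 (by positivity), rfl⟩ (fun hmem => by
      have := hC hmem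
      rw [mem_closedBall, hp _ (by positivity), add_mul, div_mul_cancel₀ _ hpos.ne'] at this
      linarith)
  have h1 := h _ hy
  rw [hp t ht] at h1
  rw [mem_closedBall, dist_eq_norm]
  nlinarith [Set.mem_Ici.1 ht]

/-- Radial projection moves points of the closure of `E` into the ball. Conversely, the closed
`ε`-thickening of a convex set is convex, so once it contains the sphere it contains the ball.
Complements follow by separation in both directions, at the cost of an arbitrarily small `η`. -/
theorem hausdorffDist_closure_ball_and_compl_le [FiniteDimensional ℝ V] [Nontrivial V] {E : Set V}
    (hE : IsOpen E) (hb : Bornology.IsBounded E) (hc : Convex ℝ E) (hne : E.Nonempty) {x₀ : V}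
    {r ε : ℝ} (hr : 0 < r) (hε : 0 ≤ ε) (h1 : ∀ x ∈ frontier E, dist x x₀ ≤ r + ε)
    (h2 : ∀ w, dist w x₀ = r → ∃ x ∈ frontier E, dist x w ≤ ε) :
    hausdorffDist (closure E) (closure (ball x₀ r)) ≤ ε ∧ hausdorffDist Eᶜ (ball x₀ r)ᶜ ≤ ε := by
  have : CompleteSpace V := FiniteDimensional.complete ℝ V
  have : ProperSpace V := FiniteDimensional.proper ℝ V
  have hcl : closure (ball x₀ r) = closedBall x₀ r := closure_ball x₀ hr.ne'
  have hA : ∀ x ∈ closure E, ∃ y ∈ closure (ball x₀ r), dist x y ≤ ε := by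
    intro x hx
    have hx' := closure_subset_closedBall_of_frontier hb (by linarith) h1 hx
    rw [hcl]
    rw [mem_closedBall] at hx'
    rcases le_total (dist x x₀) r with hle | hle
    · exact ⟨x, hle, by simpa using hε⟩
    · have hd : 0 < dist x x₀ := hr.trans_le hle
      refine ⟨x₀ + (r / dist x x₀) • (x - x₀), ?_, ?_⟩
      · rw [mem_closedBall, dist_self_add_left, norm_smul, ← dist_eq_norm,
          Real.norm_of_nonneg (by positivity), div_mul_cancel₀ _ hd.ne']
      · have : x - (x₀ + (r / dist x x₀) • (x - x₀)) = (1 - r / dist x x₀) • (x - x₀) := by module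
        rw [dist_eq_norm, this, norm_smul, ← dist_eq_norm x x₀, Real.norm_of_nonneg
          (sub_nonneg.2 ((div_le_one hd).2 hle)), sub_mul, one_mul, div_mul_cancel₀ _ hd.ne']
        linarith
  have hB : ∀ y ∈ closure (ball x₀ r), ∃ x ∈ closure E, dist y x ≤ ε := by
    have hcpt : IsCompact (closure E) := hb.isCompact_closure
    have hsub : closedBall x₀ r ⊆ cthickening ε (closure E) := by
      rw [← convexHull_sphere_eq_closedBall x₀ hr.le]
      refine convexHull_min (fun w hw => ?_) (hc.closure.cthickening ε)
      obtain ⟨x, hx, hxw⟩ := h2 w hw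
      exact mem_cthickening_of_dist_le w x ε _ (frontier_subset_closure hx) (by rwa [dist_comm])
    intro y hy
    rw [hcl] at hy
    have := hsub hy
    rw [hcpt.cthickening_eq_biUnion_closedBall hε] at this
    simpa using this
  refine ⟨hausdorffDist_le_of_mem_dist hε hA hB, le_of_forall_pos_le_add fun η hη => ?_⟩
  refine hausdorffDist_le_of_mem_dist (by linarith) (fun x hx => ?_) (fun x hx => ?_)
  · exact exists_notMem_dist_le_of_convex hE hc hne hε hη
      (fun y hy => hB y (subset_closure hy)) hx
  · exact exists_notMem_dist_le_of_convex isOpen_ball (convex_ball x₀ r) ⟨x₀, mem_ball_self hr⟩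
      hε hη (fun y hy => hA y (subset_closure hy)) hx

end ConvexHausdorff

/-! ### The perimeter of a disc -/

section PerimeterBall

open Metric Filter Topology

variable {n : ℕ}

theorem continuous_divergence {φ : EuclideanSpace ℝ (Fin n) → EuclideanSpace ℝ (Fin n)}
    (hφ : ContDiff ℝ ∞ φ) : Continuous (divergence φ) := by
  unfold divergence
  have := hφ.continuous_fderiv (by simp)
  fun_prop

theorem hasCompactSupport_divergence
    {φ : EuclideanSpace ℝ (Fin n) → EuclideanSpace ℝ (Fin n)} (hφ : HasCompactSupport φ) :
    HasCompactSupport (divergence φ) := by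
  refine (hφ.fderiv ℝ).comp_left (g := fun A : EuclideanSpace ℝ (Fin n) →L[ℝ]
    EuclideanSpace ℝ (Fin n) => ∑ i, (A (EuclideanSpace.single i 1)) i) (by simp)

theorem le_perimeter_of_testField {E : Set (EuclideanSpace ℝ (Fin n))}
    {φ : EuclideanSpace ℝ (Fin n) → EuclideanSpace ℝ (Fin n)} (h1 : ContDiff ℝ ∞ φ)
    (h2 : HasCompactSupport φ) (h3 : ∀ x, ‖φ x‖ ≤ 1) :
    ENNReal.ofReal (∫ x in E, divergence φ x) ≤ perimeter E :=
  le_iSup₂_of_le (f := fun φ (_ : φ ∈ {φ : EuclideanSpace ℝ (Fin n) → EuclideanSpace ℝ (Fin n) |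
      ContDiff ℝ ∞ φ ∧ HasCompactSupport φ ∧ ∀ x, ‖φ x‖ ≤ 1}) =>
      ENNReal.ofReal (∫ x in E, divergence φ x)) φ ⟨h1, h2, h3⟩ le_rfl

/-- Integration by parts of a divergence against a Lipschitz cutoff function. -/
theorem integral_divergence_mul_le {φ : EuclideanSpace ℝ (Fin n) → EuclideanSpace ℝ (Fin n)}
    (h1 : ContDiff ℝ ∞ φ) (h2 : HasCompactSupport φ) (h3 : ∀ x, ‖φ x‖ ≤ 1)
    {g : EuclideanSpace ℝ (Fin n) → ℝ} {C : NNReal} (hg : LipschitzWith C g)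
    (hgc : HasCompactSupport g) {A : Set (EuclideanSpace ℝ (Fin n))} (hA : MeasurableSet A)
    (hAfin : volume A ≠ ⊤) (hgA : ∀ x ∉ A, fderiv ℝ g x = 0) :
    ∫ x, divergence φ x * g x ≤ C * volume.real A := by
  have hφi : ∀ i, ContDiff ℝ ∞ fun x => φ x i := fun i => by fun_prop
  have hLip : ∀ i, ∃ D, LipschitzWith D fun x => φ x i := fun i =>
    (hφi i).lipschitzWith_of_hasCompactSupport
      (h2.comp_left (g := fun y : EuclideanSpace ℝ (Fin n) => y i) rfl) (by simp)
  have hfd : ∀ i x, lineDeriv ℝ (fun x => φ x i) x (EuclideanSpace.single i 1) =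
      (fderiv ℝ φ x (EuclideanSpace.single i 1)) i := by
    intro i x
    have hd : HasFDerivAt φ (fderiv ℝ φ x) x := (h1.differentiable (by simp) x).hasFDerivAt
    have := ((EuclideanSpace.proj (𝕜 := ℝ) i).hasFDerivAt.comp x hd)
    exact (this.hasLineDerivAt (EuclideanSpace.single i 1)).lineDeriv
  have hint1 : ∀ i, Integrable fun x =>
      lineDeriv ℝ (fun x => φ x i) x (EuclideanSpace.single i 1) * g x := by
    intro i
    simp_rw [hfd]
    have := h1.continuous_fderiv (by simp)
    have hgcont := hg.continuous
    exact Continuous.integrable_of_hasCompactSupport (by fun_prop) hgc.mul_left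
  have hint2 : ∀ i, Integrable fun x => lineDeriv ℝ g x (-EuclideanSpace.single i 1) * φ x i := by
    intro i
    have hc : Integrable fun x => φ x i := (hφi i).continuous.integrable_of_hasCompactSupport
      (h2.comp_left (g := fun y : EuclideanSpace ℝ (Fin n) => y i) rfl)
    exact hc.bdd_mul (c := C * ‖-EuclideanSpace.single i (1 : ℝ)‖)
      (measurable_lineDeriv hg.continuous).aestronglyMeasurable
      (ae_of_all _ fun x => norm_lineDeriv_le_of_lipschitz ℝ hg)
  have e1 : ∫ x, divergence φ x * g x =
      ∫ x, ∑ i, lineDeriv ℝ g x (-EuclideanSpace.single i 1) * φ x i := by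
    rw [integral_finsetSum _ fun i _ => hint2 i]
    calc _ = ∫ x, ∑ i, lineDeriv ℝ (fun x => φ x i) x (EuclideanSpace.single i 1) * g x := by
          simp_rw [hfd, ← Finset.sum_mul]; rfl
      _ = _ := by
          rw [integral_finsetSum _ fun i _ => hint1 i]
          refine Finset.sum_congr rfl fun i _ => ?_
          obtain ⟨D, hD⟩ := hLip i
          exact hD.integral_lineDeriv_mul_eq hg hgc _
  have e2 : ∀ᵐ x, ∑ i, lineDeriv ℝ g x (-EuclideanSpace.single i 1) * φ x i ≤
      A.indicator (fun _ => (C : ℝ)) x := by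
    -- Rademacher's theorem: almost everywhere the sum of directional derivatives is `-∇g · φ`,
    -- which is at most `C` and vanishes off `A`.
    filter_upwards [hg.ae_differentiableAt] with x hx
    have e3 : ∑ i, lineDeriv ℝ g x (-EuclideanSpace.single i 1) * φ x i = -fderiv ℝ g x (φ x) := by
      have hsum : φ x = ∑ i, φ x i • EuclideanSpace.single i (1 : ℝ) := by
        conv_lhs => rw [← (EuclideanSpace.basisFun (Fin n) ℝ).sum_repr (φ x)]
        simp
      conv_rhs => rw [hsum]
      rw [map_sum, ← Finset.sum_neg_distrib]
      refine Finset.sum_congr rfl fun i _ => ?_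
      rw [hx.lineDeriv_eq_fderiv, map_neg, map_smul, smul_eq_mul]
      ring
    rw [e3]
    by_cases hxA : x ∈ A
    · rw [Set.indicator_of_mem hxA]
      calc -fderiv ℝ g x (φ x) ≤ ‖fderiv ℝ g x (φ x)‖ := neg_le_abs _
        _ ≤ ‖fderiv ℝ g x‖ * ‖φ x‖ := (fderiv ℝ g x).le_opNorm _
        _ ≤ C * 1 := mul_le_mul (norm_fderiv_le_of_lipschitz ℝ hg) (h3 x) (norm_nonneg _) C.2
        _ = C := mul_one _
    · rw [Set.indicator_of_notMem hxA, hgA x hxA]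
      simp
  rw [e1]
  calc _ ≤ ∫ x, A.indicator (fun _ => (C : ℝ)) x :=
        integral_mono_ae (integrable_finsetSum _ fun i _ => hint2 i)
          ((integrable_indicator_iff hA).2 (integrableOn_const hAfin)) e2
    _ = _ := by
        rw [integral_indicator hA, setIntegral_const, smul_eq_mul, mul_comm]

/-- The indicator of the disc is replaced by a cutoff falling from `1` to `0` across an annulus of
width `ε`. Its slope `1/ε` times the annulus area `π(2R + ε)ε` tends to `2πR`, and the error of the
replacement is at most the annulus area times `sup |div φ|`. -/
theorem integral_ball_divergence_le {φ : EuclideanSpace ℝ (Fin 2) → EuclideanSpace ℝ (Fin 2)}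
    (h1 : ContDiff ℝ ∞ φ) (h2 : HasCompactSupport φ) (h3 : ∀ x, ‖φ x‖ ≤ 1)
    (x₀ : EuclideanSpace ℝ (Fin 2)) {R : ℝ} (hR : 0 < R) :
    ∫ x in ball x₀ R, divergence φ x ≤ 2 * Real.pi * R := by
  have hdc := continuous_divergence h1
  have hdi : Integrable (divergence φ) :=
    hdc.integrable_of_hasCompactSupport (hasCompactSupport_divergence h2)
  obtain ⟨M, hM⟩ := hdc.bounded_above_of_compact_support (hasCompactSupport_divergence h2)
  have key : ∀ ε : ℝ, 0 < ε →
      ∫ x in ball x₀ R, divergence φ x ≤ Real.pi * (2 * R + ε) * (1 + M * ε) := by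
    intro ε hε
    let g : EuclideanSpace ℝ (Fin 2) → ℝ := fun x => max 0 (min 1 ((R + ε - dist x x₀) * ε⁻¹))
    let A := closedBall x₀ (R + ε) \ ball x₀ R
    have hA : MeasurableSet A := measurableSet_closedBall.diff measurableSet_ball
    have hAfin : volume A ≠ ⊤ :=
      ((measure_mono Set.sdiff_subset).trans_lt measure_closedBall_lt_top).ne
    have hAvol : volume.real A = Real.pi * (2 * R + ε) * ε := by
      rw [measureReal_sdiff (ball_subset_closedBall.trans (closedBall_subset_closedBall (by linarith)))
        measurableSet_ball measure_closedBall_lt_top.ne, measureReal_def, measureReal_def,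
        EuclideanSpace.volume_closedBall_fin_two, EuclideanSpace.volume_ball_fin_two]
      simp only [ENNReal.toReal_mul, ENNReal.toReal_pow, ENNReal.toReal_ofReal hR.le,
        ENNReal.toReal_ofReal (by linarith : 0 ≤ R + ε), ENNReal.toReal_ofReal Real.pi_pos.le]
      ring
    have hin : ∀ x ∈ ball x₀ R, g x = 1 := by
      intro x hx
      rw [mem_ball] at hx
      have : 1 ≤ (R + ε - dist x x₀) * ε⁻¹ := by
        rw [← div_eq_mul_inv, le_div_iff₀ hε]; linarith
      simp [g, min_eq_left this]
    have hout : ∀ x ∉ closedBall x₀ (R + ε), g x = 0 := by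
      intro x hx
      rw [mem_closedBall, not_le] at hx
      have : (R + ε - dist x x₀) * ε⁻¹ ≤ 0 :=
        mul_nonpos_of_nonpos_of_nonneg (by linarith) (by positivity)
      exact max_eq_left ((min_le_right _ _).trans this)
    have hC : ((Real.toNNReal ε⁻¹ : NNReal) : ℝ) = ε⁻¹ := Real.coe_toNNReal _ (by positivity)
    have hg : LipschitzWith (Real.toNNReal ε⁻¹) g := by
      refine LipschitzWith.const_max (LipschitzWith.const_min ?_ 1) 0
      refine LipschitzWith.of_dist_le_mul fun x y => ?_
      rw [hC, Real.dist_eq, ← sub_mul, abs_mul, abs_of_pos (inv_pos.2 hε), mul_comm,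
        show R + ε - dist x x₀ - (R + ε - dist y x₀) = dist y x₀ - dist x x₀ by ring]
      refine mul_le_mul_of_nonneg_left ?_ (inv_nonneg.2 hε.le)
      rw [dist_comm x y]
      exact abs_dist_sub_le y x x₀
    have hgc : HasCompactSupport g :=
      HasCompactSupport.intro (isCompact_closedBall x₀ (R + ε)) hout
    have hgA : ∀ x ∉ A, fderiv ℝ g x = 0 := by
      intro x hx
      have hx' : x ∉ closedBall x₀ (R + ε) ∨ x ∈ ball x₀ R := by
        by_contra! hcon
        exact hx hcon
      rcases hx' with h | h
      · have : g =ᶠ[𝓝 x] fun _ => 0 :=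
          Filter.mem_of_superset
          (isClosed_closedBall.isOpen_compl.mem_nhds h) hout
        rw [this.fderiv_eq]
        simp
      · have : g =ᶠ[𝓝 x] fun _ => 1 := Filter.mem_of_superset (isOpen_ball.mem_nhds h) hin
        rw [this.fderiv_eq]
        simp
    have hgi : Integrable fun x => divergence φ x * g x :=
      (hdc.mul hg.continuous).integrable_of_hasCompactSupport hgc.mul_left
    have hb1 := integral_divergence_mul_le h1 h2 h3 hg hgc hA hAfin hgA
    have hb2 : ∫ x in ball x₀ R, divergence φ x ≤
        (∫ x, divergence φ x * g x) + M * volume.real A := by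
      have hIA : Integrable (A.indicator fun _ => M) :=
        (integrable_indicator_iff hA).2 (integrableOn_const hAfin)
      rw [← integral_indicator measurableSet_ball, mul_comm M, ← smul_eq_mul (volume.real A),
        ← setIntegral_const, ← integral_indicator hA, ← integral_add hgi hIA]
      refine integral_mono (hdi.indicator measurableSet_ball) (hgi.add hIA) fun x => ?_
      have hMx := (abs_le.1 (hM x)).1
      by_cases hx : x ∈ ball x₀ R
      · have : x ∉ A := fun h => h.2 hx
        simp [hx, this, hin x hx]
      · by_cases hx2 : x ∈ closedBall x₀ (R + ε)
        · have hxA : x ∈ A := ⟨hx2, hx⟩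
          simp only [Set.indicator_of_notMem hx, Set.indicator_of_mem hxA]
          have hM0 : 0 ≤ M := (norm_nonneg _).trans (hM x)
          have hg0 : 0 ≤ g x := le_max_left _ _
          have hg1 : g x ≤ 1 := max_le zero_le_one (min_le_left _ _)
          nlinarith [mul_le_mul_of_nonneg_right hMx hg0]
        · have : x ∉ A := fun h => hx2 h.1
          simp [hx, this, hout x hx2]
    rw [hAvol] at hb1 hb2
    have e : ε⁻¹ * (Real.pi * (2 * R + ε) * ε) = Real.pi * (2 * R + ε) := by field_simp
    rw [hC, e] at hb1
    calc _ ≤ _ := hb2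
      _ ≤ Real.pi * (2 * R + ε) + M * (Real.pi * (2 * R + ε) * ε) := by linarith
      _ = _ := by ring
  have lim : Tendsto (fun ε : ℝ => Real.pi * (2 * R + ε) * (1 + M * ε)) (𝓝[>] 0)
      (𝓝 (Real.pi * (2 * R + 0) * (1 + M * 0))) :=
    (Continuous.tendsto (by fun_prop) 0).mono_left nhdsWithin_le_nhds
  have := ge_of_tendsto lim (eventually_mem_nhdsWithin.mono key)
  linarith

/-- The radial field `(t/R)(x - x₀)` has divergence `2t/R`. The factor `t < 1` leaves room to cut it
off between radii `R` and `R/t` while keeping its norm at most `1`. -/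
theorem exists_testField_ball (x₀ : EuclideanSpace ℝ (Fin 2)) {R t : ℝ} (hR : 0 < R)
    (ht0 : 0 < t) (ht1 : t < 1) :
    ENNReal.ofReal (2 * Real.pi * R * t) ≤ perimeter (ball x₀ R) := by
  let χ : ContDiffBump x₀ := ⟨R, R / t, hR, by rw [lt_div_iff₀ ht0]; nlinarith⟩
  let φ : EuclideanSpace ℝ (Fin 2) → EuclideanSpace ℝ (Fin 2) :=
    fun x => (t / R * χ x) • (x - x₀)
  have h1 : ContDiff ℝ ∞ φ := by
    have : ContDiff ℝ ∞ χ := χ.contDiff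
    fun_prop
  have h2 : HasCompactSupport φ :=
    (χ.hasCompactSupport.mul_left (f := fun _ => t / R)).smul_right
  have h3 : ∀ x, ‖φ x‖ ≤ 1 := by
    intro x
    by_cases hx : x ∈ ball x₀ (R / t)
    · rw [mem_ball, dist_eq_norm] at hx
      rw [norm_smul, Real.norm_of_nonneg (mul_nonneg (by positivity) χ.nonneg)]
      calc t / R * χ x * ‖x - x₀‖ ≤ t / R * 1 * (R / t) := by
            gcongr
            exact χ.le_one
        _ = 1 := by field_simp
    · have : χ x = 0 := by
        rw [← Function.notMem_support, χ.support_eq]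
        exact hx
      simp [φ, this]
  have hdiv : ∀ x ∈ ball x₀ R, divergence φ x = 2 * (t / R) := by
    intro x hx
    have e : φ =ᶠ[𝓝 x] fun y => (t / R) • (y - x₀) := by
      filter_upwards [isOpen_ball.mem_nhds hx] with y hy
      have : χ y = 1 := χ.one_of_mem_closedBall (ball_subset_closedBall hy)
      simp [φ, this]
    have hd : fderiv ℝ φ x = (t / R) • ContinuousLinearMap.id ℝ (EuclideanSpace ℝ (Fin 2)) := by
      rw [e.fderiv_eq]
      exact (((hasFDerivAt_id x).sub_const x₀).const_smul (t / R)).fderiv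
    simp [divergence, hd]
  refine le_trans (le_of_eq ?_) (le_perimeter_of_testField h1 h2 h3)
  rw [setIntegral_congr_fun measurableSet_ball hdiv, setIntegral_const, measureReal_def,
    EuclideanSpace.volume_ball_fin_two]
  simp only [ENNReal.toReal_mul, ENNReal.toReal_pow, ENNReal.toReal_ofReal hR.le,
    ENNReal.toReal_ofReal Real.pi_pos.le, smul_eq_mul]
  congr 1
  field_simp

/-- The perimeter of a disc. -/
theorem perimeter_ball (x₀ : EuclideanSpace ℝ (Fin 2)) {R : ℝ} (hR : 0 < R) :
    perimeter (ball x₀ R) = ENNReal.ofReal (2 * Real.pi * R) := by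
  apply le_antisymm
  · exact iSup₂_le fun φ hφ =>
      ENNReal.ofReal_le_ofReal (integral_ball_divergence_le hφ.1 hφ.2.1 hφ.2.2 x₀ hR)
  · have lim : Tendsto (fun t : ℝ => ENNReal.ofReal (2 * Real.pi * R * t)) (𝓝[<] 1)
        (𝓝 (ENNReal.ofReal (2 * Real.pi * R * 1))) :=
      ((ENNReal.continuous_ofReal.comp (continuous_const_mul _)).tendsto 1).mono_left
        nhdsWithin_le_nhds
    rw [mul_one] at lim
    exact le_of_tendsto lim (by
      filter_upwards [Ioo_mem_nhdsLT one_pos] with t ht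
      exact exists_testField_ball x₀ hR ht.1 ht.2)

end PerimeterBall

/-! ### Fluxes through convex sets by slicing along lines -/

section ConvexSlices

open Metric Filter Topology

local notation "ℝ²" => EuclideanSpace ℝ (Fin 2)

/-- Coordinates in an orthonormal frame with origin `p` preserve the Lebesgue measure. -/
theorem measurePreserving_frame (b : OrthonormalBasis (Fin 2) ℝ ℝ²) (p : ℝ²) :
    MeasurePreserving (fun z : ℝ × ℝ => p + z.1 • b 0 + z.2 • b 1) := by
  have h1 := (volume_preserving_finTwoArrow ℝ).symm
  have h2 := PiLp.volume_preserving_toLp (Fin 2)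
  have h3 := b.measurePreserving_repr_symm
  have h4 := measurePreserving_add_left (volume : Measure ℝ²) p
  have e : (fun z : ℝ × ℝ => p + z.1 • b 0 + z.2 • b 1) = (fun x => p + x) ∘ b.repr.symm ∘
      WithLp.toLp 2 ∘ MeasurableEquiv.finTwoArrow.symm := by
    ext1 z
    simp only [Function.comp_apply, add_assoc, add_right_inj]
    rw [← b.sum_repr_symm, Fin.sum_univ_two]
    rfl
  rw [e]
  exact h4.comp (h3.comp (h2.comp h1))

theorem integrable_frame (b : OrthonormalBasis (Fin 2) ℝ ℝ²) (p : ℝ²) {F : ℝ² → ℝ}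
    (hF : Integrable F) : Integrable fun z : ℝ × ℝ => F (p + z.1 • b 0 + z.2 • b 1) :=
  (measurePreserving_frame b p).integrable_comp_of_integrable hF

theorem integral_eq_integral_frame (b : OrthonormalBasis (Fin 2) ℝ ℝ²) (p : ℝ²) {F : ℝ² → ℝ}
    (hF : Integrable F) :
    ∫ x, F x = ∫ t : ℝ, ∫ s : ℝ, F (p + t • b 0 + s • b 1) := by
  have hmp := measurePreserving_frame b p
  have e : ∫ x, F x = ∫ z : ℝ × ℝ, F (p + z.1 • b 0 + z.2 • b 1) := by
    rw [← hmp.map_eq, integral_map hmp.aemeasurable]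
    rw [hmp.map_eq]
    exact hF.aestronglyMeasurable
  rw [e, Measure.volume_eq_prod, integral_prod]
  exact integrable_frame b p hF

theorem eq_Ioo_of_isOpen_of_convex {s : Set ℝ} (ho : IsOpen s) (hc : Convex ℝ s) {a b : ℝ}
    (ha : IsGLB s a) (hb : IsLUB s b) : s = Set.Ioo a b := by
  ext x
  constructor
  · intro hx
    obtain ⟨ε, hε, hball⟩ := Metric.isOpen_iff.1 ho x hx
    have h1 : x - ε / 2 ∈ s := hball (by simp [abs_of_pos hε, hε])
    have h2 : x + ε / 2 ∈ s := hball (by simp [abs_of_pos hε, hε])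
    exact ⟨by linarith [ha.1 h1], by linarith [hb.1 h2]⟩
  · rintro ⟨h1, h2⟩
    obtain ⟨y, hy, hy1, hy2⟩ := ha.exists_between h1
    obtain ⟨z, hz, hz1, hz2⟩ := hb.exists_between h2
    exact hc.ordConnected.out hy hz ⟨hy2.le, hz1.le⟩

variable {E : Set (EuclideanSpace ℝ (Fin 2))}

/-- An open convex set meets a line in an open interval, so the fundamental theorem of calculus
leaves only the two end points. -/
theorem integral_slice_eq {η : ℝ² → ℝ} (hη : ContDiff ℝ ∞ η) (hE : IsOpen E) (hc : Convex ℝ E)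
    (p ν : ℝ²) {a b : ℝ} (ha : IsGLB {s : ℝ | p + s • ν ∈ E} a)
    (hb : IsLUB {s : ℝ | p + s • ν ∈ E} b) (hne : {s : ℝ | p + s • ν ∈ E}.Nonempty) :
    ∫ s : ℝ, E.indicator (fun x => fderiv ℝ η x ν) (p + s • ν) =
      η (p + b • ν) - η (p + a • ν) := by
  set S := {s : ℝ | p + s • ν ∈ E}
  have hSo : IsOpen S := hE.preimage (f := fun s : ℝ => p + s • ν) (by fun_prop)
  have hSc : Convex ℝ S := by
    have e : S = (AffineMap.lineMap p (p + ν) : ℝ →ᵃ[ℝ] ℝ²) ⁻¹' E := by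
      ext s
      simp [S, AffineMap.lineMap_apply, add_comm]
    rw [e]
    exact hc.affine_preimage _
  have hS := eq_Ioo_of_isOpen_of_convex hSo hSc ha hb
  have hab : a ≤ b := isGLB_le_isLUB ha hb hne
  have e : (fun s : ℝ => E.indicator (fun x => fderiv ℝ η x ν) (p + s • ν)) =
      S.indicator fun s => fderiv ℝ η (p + s • ν) ν := rfl
  rw [e, integral_indicator hSo.measurableSet, hS, ← integral_Ioc_eq_integral_Ioo,
    ← intervalIntegral.integral_of_le hab]
  have hd : ∀ s : ℝ, HasDerivAt (fun s : ℝ => η (p + s • ν)) (fderiv ℝ η (p + s • ν) ν) s := by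
    intro s
    have h1 : HasDerivAt (fun s : ℝ => p + s • ν) ν s := by
      simpa using ((hasDerivAt_id s).smul_const ν).const_add p
    exact (hη.differentiable (by simp) (p + s • ν)).hasFDerivAt.comp_hasDerivAt s h1
  have hcont := hη.continuous_fderiv (by simp)
  exact intervalIntegral.integral_eq_sub_of_hasDerivAt (fun s _ => hd s)
    (Continuous.intervalIntegrable (by fun_prop) _ _)

theorem exists_isGLB_isLUB_slice (hb : Bornology.IsBounded E) (p : ℝ²) {ν : ℝ²} (hν : ‖ν‖ = 1)
    (hne : {s : ℝ | p + s • ν ∈ E}.Nonempty) :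
    (∃ a, IsGLB {s : ℝ | p + s • ν ∈ E} a) ∧ ∃ b, IsLUB {s : ℝ | p + s • ν ∈ E} b := by
  have hbd : Bornology.IsBounded {s : ℝ | p + s • ν ∈ E} := by
    obtain ⟨R, hR⟩ := hb.subset_closedBall p
    refine (isBounded_closedBall (x := (0 : ℝ)) (r := R)).subset fun s hs => ?_
    have := hR hs
    rw [mem_closedBall, dist_self_add_left, norm_smul, hν, mul_one] at this
    simpa using this
  exact ⟨⟨_, isGLB_csInf hne hbd.bddBelow⟩, ⟨_, isLUB_csSup hne hbd.bddAbove⟩⟩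

theorem integrable_indicator_fderiv (hE : IsOpen E) (hb : Bornology.IsBounded E) {η : ℝ² → ℝ}
    (hη : ContDiff ℝ ∞ η) (ν : ℝ²) :
    Integrable (E.indicator fun x => fderiv ℝ η x ν) := by
  have hcont := hη.continuous_fderiv (by simp)
  rw [integrable_indicator_iff hE.measurableSet]
  exact (Continuous.continuousOn (by fun_prop)).integrableOn_compact hb.isCompact_closure
    |>.mono_set subset_closure

/-- The flux through a bounded convex set of a field `η ν` with constant direction `ν`. -/
theorem abs_setIntegral_fderiv_le (hE : IsOpen E) (hc : Convex ℝ E) {R : ℝ}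
    (hER : E ⊆ closedBall 0 R) {η : ℝ² → ℝ} (hη : ContDiff ℝ ∞ η) (hη1 : ∀ x, |η x| ≤ 1)
    (b : OrthonormalBasis (Fin 2) ℝ ℝ²) :
    |∫ x in E, fderiv ℝ η x (b 1)| ≤ 2 * (volume.real (Set.Icc (-R) R)) := by
  have hb : Bornology.IsBounded E := isBounded_closedBall.subset hER
  have hint := integrable_indicator_fderiv hE hb hη (b 1)
  rw [← integral_indicator hE.measurableSet, integral_eq_integral_frame b 0 hint, mul_comm,
    ← smul_eq_mul, ← setIntegral_const, ← integral_indicator measurableSet_Icc, ← Real.norm_eq_abs]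
  refine norm_integral_le_of_norm_le
    ((integrable_indicator_iff measurableSet_Icc).2 (integrableOn_const (by simp)))
    (ae_of_all _ fun t => ?_)
  rcases Set.eq_empty_or_nonempty {s : ℝ | (0 + t • b 0) + s • b 1 ∈ E} with he | hne
  · have : ∀ s : ℝ, E.indicator (fun x => fderiv ℝ η x (b 1)) (0 + t • b 0 + s • b 1) = 0 :=
      fun s => Set.indicator_of_notMem (fun hmem : _ ∈ E => (Set.ext_iff.1 he s).1 hmem) _
    simp_rw [this]
    simpa using Set.indicator_nonneg (fun _ _ => zero_le_two) t
  · obtain ⟨⟨a₁, h1⟩, ⟨b₁, h2⟩⟩ := exists_isGLB_isLUB_slice hb (0 + t • b 0) (b.norm_eq_one 1) hne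
    obtain ⟨s, hs⟩ := hne
    have ht : t ∈ Set.Icc (-R) R := by
      have h3 := hER hs
      rw [mem_closedBall_zero_iff] at h3
      have h4 : inner ℝ (b 0) (0 + t • b 0 + s • b 1) = t := by
        simp [inner_add_right, inner_smul_right]
      have h5 := abs_real_inner_le_norm (b 0) (0 + t • b 0 + s • b 1)
      rw [h4, b.norm_eq_one, one_mul] at h5
      exact abs_le.1 (h5.trans h3)
    rw [integral_slice_eq hη hE hc _ _ h1 h2 ⟨s, hs⟩, Set.indicator_of_mem ht, Real.norm_eq_abs]
    exact (abs_sub _ _).trans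
      (by linarith [hη1 (0 + t • b 0 + b₁ • b 1), hη1 (0 + t • b 0 + a₁ • b 1)])

/-- If every line in direction `b 1` over `(0, l)` leaves `E` in `U` and enters it outside `U`,
and if cutoffs of `U` increase to `1`, then the fluxes of these cutoffs tend to `l`. -/
theorem tendsto_setIntegral_fderiv (hE : IsOpen E) (hc : Convex ℝ E) (hb : Bornology.IsBounded E)
    {b : OrthonormalBasis (Fin 2) ℝ ℝ²} {p : ℝ²} {l : ℝ} (hl : 0 ≤ l) {U : Set ℝ²}
    (hUl : ∀ t s : ℝ, p + t • b 0 + s • b 1 ∈ U → t ∈ Set.Ioo 0 l)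
    (hne : ∀ t ∈ Set.Ioo 0 l, ∃ s : ℝ, p + t • b 0 + s • b 1 ∈ E)
    (hup : ∀ t ∈ Set.Ioo 0 l, ∀ s, IsLUB {s : ℝ | p + t • b 0 + s • b 1 ∈ E} s →
      p + t • b 0 + s • b 1 ∈ U)
    (hlow : ∀ t ∈ Set.Ioo 0 l, ∀ s, IsGLB {s : ℝ | p + t • b 0 + s • b 1 ∈ E} s →
      p + t • b 0 + s • b 1 ∉ U)
    {η : ℕ → ℝ² → ℝ} (hη : ∀ n, ContDiff ℝ ∞ (η n)) (hη0 : ∀ n x, 0 ≤ η n x)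
    (hη1 : ∀ n x, η n x ≤ 1) (hηU : ∀ n, ∀ x ∉ U, η n x = 0)
    (hlim : ∀ x ∈ U, Tendsto (fun n => η n x) atTop (𝓝 1)) :
    Tendsto (fun n => ∫ x in E, fderiv ℝ (η n) x (b 1)) atTop (𝓝 l) := by
  have hint := fun n => integrable_indicator_fderiv hE hb (hη n) (b 1)
  have e : ∀ n, ∫ x in E, fderiv ℝ (η n) x (b 1) = ∫ t : ℝ, ∫ s : ℝ,
      E.indicator (fun x => fderiv ℝ (η n) x (b 1)) (p + t • b 0 + s • b 1) := fun n => by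
    rw [← integral_indicator hE.measurableSet, integral_eq_integral_frame b p (hint n)]
  have hl' : l = ∫ t : ℝ, (Set.Ioo 0 l).indicator (fun _ => (1 : ℝ)) t := by
    rw [integral_indicator measurableSet_Ioo, setIntegral_const]
    simp [hl]
  simp_rw [e]
  rw [hl']
  -- The cutoff vanishes at the entry point, which lies outside `U`; only its value at the exit
  -- point `u` is left, and this value tends to `1`.
  have hin : ∀ t ∈ Set.Ioo 0 l, ∃ u ∈ U, ∀ n, ∫ s : ℝ,
      E.indicator (fun x => fderiv ℝ (η n) x (b 1)) (p + t • b 0 + s • b 1) = η n u := by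
    intro t ht
    obtain ⟨⟨a₁, h1⟩, ⟨b₁, h2⟩⟩ :=
      exists_isGLB_isLUB_slice hb (p + t • b 0) (b.norm_eq_one 1) (hne t ht)
    refine ⟨_, hup t ht b₁ h2, fun n => ?_⟩
    rw [integral_slice_eq (hη n) hE hc _ _ h1 h2 (hne t ht), hηU n _ (hlow t ht a₁ h1), sub_zero]
  have hout : ∀ t ∉ Set.Ioo 0 l, ∀ n, ∫ s : ℝ,
      E.indicator (fun x => fderiv ℝ (η n) x (b 1)) (p + t • b 0 + s • b 1) = 0 := by
    intro t ht n
    rcases Set.eq_empty_or_nonempty {s : ℝ | p + t • b 0 + s • b 1 ∈ E} with he | hne'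
    · have : ∀ s : ℝ, E.indicator (fun x => fderiv ℝ (η n) x (b 1)) (p + t • b 0 + s • b 1) = 0 :=
        fun s => Set.indicator_of_notMem (fun hmem : _ ∈ E => (Set.ext_iff.1 he s).1 hmem) _
      simp [this]
    · obtain ⟨⟨a₁, h1⟩, ⟨b₁, h2⟩⟩ :=
        exists_isGLB_isLUB_slice hb (p + t • b 0) (b.norm_eq_one 1) hne'
      rw [integral_slice_eq (hη n) hE hc _ _ h1 h2 hne', hηU n _ fun h => ht (hUl _ _ h),
        hηU n _ fun h => ht (hUl _ _ h), sub_zero]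
  refine tendsto_integral_of_dominated_convergence
    ((Set.Ioo 0 l).indicator fun _ => (1 : ℝ)) (fun n => ?_)
    ((integrable_indicator_iff measurableSet_Ioo).2 (integrableOn_const (by simp)))
    (fun n => ae_of_all _ fun t => ?_) (ae_of_all _ fun t => ?_)
  · exact (integrable_frame b p (hint n)).integral_prod_left.aestronglyMeasurable
  · by_cases ht : t ∈ Set.Ioo 0 l
    · obtain ⟨u, -, hu⟩ := hin t ht
      rw [hu, Set.indicator_of_mem ht, Real.norm_of_nonneg (hη0 n u)]
      exact hη1 n u
    · rw [hout t ht, Set.indicator_of_notMem ht, norm_zero]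
  · by_cases ht : t ∈ Set.Ioo 0 l
    · obtain ⟨u, huU, hu⟩ := hin t ht
      simp_rw [hu, Set.indicator_of_mem ht]
      exact hlim u huU
    · simp_rw [hout t ht, Set.indicator_of_notMem ht]
      exact tendsto_const_nhds

/-- Each component of a test field is a flux in a coordinate direction, bounded by slicing.
Finiteness is needed because `toReal` sends `⊤` to `0`. -/
theorem perimeter_ne_top_of_convex (hE : IsOpen E) (hc : Convex ℝ E)
    (hb : Bornology.IsBounded E) : perimeter E ≠ ⊤ := by
  obtain ⟨R, hR⟩ := hb.subset_closedBall 0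
  refine ne_top_of_le_ne_top (b := ENNReal.ofReal
    (∑ _i : Fin 2, 2 * (volume.real (Set.Icc (-R) R)))) ENNReal.ofReal_ne_top
    (iSup₂_le fun φ hφ => ENNReal.ofReal_le_ofReal ?_)
  obtain ⟨h1, h2, h3⟩ := hφ
  have hφi : ∀ i, ContDiff ℝ ∞ fun x => φ x i := fun i => by fun_prop
  have hfd : ∀ i x v, (fderiv ℝ φ x v) i = fderiv ℝ (fun x => φ x i) x v := by
    intro i x v
    have hd : HasFDerivAt φ (fderiv ℝ φ x) x := (h1.differentiable (by simp) x).hasFDerivAt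
    have := ((EuclideanSpace.proj (𝕜 := ℝ) i).hasFDerivAt.comp x hd)
    have h4 : fderiv ℝ (fun x => φ x i) x = _ := this.fderiv
    rw [h4]
    rfl
  have hle : ∀ i, ∫ x in E, (fderiv ℝ φ x (EuclideanSpace.single i 1)) i ≤
      2 * (volume.real (Set.Icc (-R) R)) := by
    intro i
    simp_rw [hfd]
    let b := (EuclideanSpace.basisFun (Fin 2) ℝ).reindex (Equiv.swap i 1)
    have hbi : b 1 = EuclideanSpace.single i 1 := by simp [b]
    rw [← hbi]
    refine (le_abs_self _).trans (abs_setIntegral_fderiv_le hE hc hR (hφi i) (fun x => ?_) b)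
    exact (PiLp.norm_apply_le (φ x) i).trans (h3 x)
  unfold divergence
  rw [integral_finsetSum]
  · exact Finset.sum_le_sum fun i _ => hle i
  · intro i _
    simp_rw [hfd]
    exact (integrable_indicator_iff hE.measurableSet).1 (integrable_indicator_fderiv hE hb (hφi i) _)

end ConvexSlices

/-! ### Inscribed polygons are no longer than the perimeter -/

section PolygonBound

open Metric Filter Topology

local notation "ℝ²" => EuclideanSpace ℝ (Fin 2)

/-- The oriented area spanned by two vectors of the plane. -/
def planeCross (u v : EuclideanSpace ℝ (Fin 2)) : ℝ := u 0 * v 1 - u 1 * v 0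

theorem continuous_planeCross_left (v : ℝ²) : Continuous fun u => planeCross u v := by
  unfold planeCross; fun_prop

theorem continuous_planeCross_right (u : ℝ²) : Continuous fun v => planeCross u v := by
  unfold planeCross; fun_prop

/-- Cramer's rule in the plane. -/
theorem planeCross_smul_eq (u v w : ℝ²) :
    planeCross u v • w = planeCross w v • u + planeCross u w • v := by
  ext i
  fin_cases i <;> simp [planeCross] <;> ring

/-- The vertex `o` is interior and has positive weight `1 - u - v`, so the combination is interior
even if `x` and `y` are only in the closure. -/
theorem Convex.add_smul_add_smul_mem {V : Type*} [NormedAddCommGroup V] [NormedSpace ℝ V]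
    {E : Set V} (hE : IsOpen E) (hc : Convex ℝ E) {o x y : V} (ho : o ∈ E) (hx : x ∈ closure E)
    (hy : y ∈ closure E) {u v : ℝ} (hu : 0 ≤ u) (hv : 0 ≤ v) (huv : u + v < 1) :
    o + u • (x - o) + v • (y - o) ∈ E := by
  rcases (add_nonneg hu hv).eq_or_lt with h0 | hpos
  · have hu0 : u = 0 := by linarith
    have hv0 : v = 0 := by linarith
    simpa [hu0, hv0] using ho
  · have hz : (u / (u + v)) • x + (v / (u + v)) • y ∈ closure E :=
      hc.closure hx hy (by positivity) (by positivity) (by field_simp)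
    have := hc.combo_interior_closure_mem_interior (by rwa [hE.interior_eq]) hz
      (sub_pos.2 huv) hpos.le (sub_add_cancel _ _)
    rw [hE.interior_eq] at this
    convert this using 1
    rw [smul_add, smul_smul, smul_smul, mul_div_cancel₀ _ hpos.ne', mul_div_cancel₀ _ hpos.ne']
    module

theorem exists_orthonormalBasis_of_unit {τ : ℝ²} (hτ : ‖τ‖ = 1) :
    ∃ b : OrthonormalBasis (Fin 2) ℝ ℝ², b 0 = τ ∧ b 1 = !₂[τ 1, -τ 0] := by
  have h1 : τ 0 ^ 2 + τ 1 ^ 2 = 1 := by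
    have := EuclideanSpace.norm_sq_eq τ
    rw [hτ, Fin.sum_univ_two] at this
    simpa using this.symm
  have hon : Orthonormal ℝ ![τ, !₂[τ 1, -τ 0]] := by
    rw [orthonormal_iff_ite]
    intro i j
    fin_cases i <;> fin_cases j <;> simp [PiLp.inner_apply, Fin.sum_univ_two,
      -inner_self_eq_norm_sq_to_K] <;> nlinarith
  obtain ⟨b, hb⟩ := Orthonormal.exists_orthonormalBasis_extension_of_card_eq (𝕜 := ℝ)
    (E := ℝ²) (ι := Fin 2) (by simp) (s := Set.univ) (hon.comp _ Subtype.val_injective)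
  exact ⟨b, hb 0 trivial, hb 1 trivial⟩

variable {E : Set (EuclideanSpace ℝ (Fin 2))}

/-- Compose `n f` with a smooth step, where `f` is smooth, nonnegative and nonzero exactly on `U`:
at a point of `U` the value is eventually `1`. -/
theorem exists_cutoff_tendsto_one {U : Set ℝ²} (hU : IsOpen U) (hb : Bornology.IsBounded U) :
    ∃ η : ℕ → ℝ² → ℝ, (∀ n, ContDiff ℝ ∞ (η n)) ∧ (∀ n, HasCompactSupport (η n)) ∧
      (∀ n x, 0 ≤ η n x) ∧ (∀ n x, η n x ≤ 1) ∧ (∀ n, ∀ x ∉ U, η n x = 0) ∧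
      ∀ x ∈ U, Tendsto (fun n => η n x) atTop (𝓝 1) := by
  obtain ⟨f, hf, hfd, hfr⟩ := hU.exists_contDiff_support_eq (n := ⊤)
  have h0 : ∀ n : ℕ, ∀ x ∉ U, Real.smoothTransition (n * f x) = 0 := by
    intro n x hx
    have : f x = 0 := by rwa [← hf, Function.notMem_support] at hx
    rw [this, mul_zero, Real.smoothTransition.zero]
  refine ⟨fun n x => Real.smoothTransition (n * f x), fun n => ?_, fun n => ?_,
    fun n x => Real.smoothTransition.nonneg _, fun n x => Real.smoothTransition.le_one _, h0,
    fun x hx => ?_⟩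
  · exact Real.smoothTransition.contDiff.comp (contDiff_const.mul hfd)
  · exact HasCompactSupport.intro hb.isCompact_closure fun x hx =>
      h0 n x fun h => hx (subset_closure h)
  · have hpos : 0 < f x := by
      have h1 : f x ≠ 0 := by rwa [← hf] at hx
      exact lt_of_le_of_ne (hfr ⟨x, rfl⟩).1 h1.symm
    have hev : ∀ᶠ n : ℕ in atTop, 1 ≤ n * f x :=
      (tendsto_natCast_atTop_atTop.atTop_mul_const hpos).eventually_ge_atTop 1
    exact tendsto_const_nhds.congr' (hev.mono fun n hn =>
      (Real.smoothTransition.one_of_one_le hn).symm)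

/-- Test fields in the cone over a boundary arc whose flux recovers the length of the chord. -/
theorem exists_testField_chord (hE : IsOpen E) (hc : Convex ℝ E) (hb : Bornology.IsBounded E)
    {o p q : ℝ²} (ho : o ∈ E) (hp : p ∈ frontier E) (hq : q ∈ frontier E)
    (hpq : 0 < planeCross (p - o) (q - o)) :
    ∃ (ν : ℝ²) (η : ℕ → ℝ² → ℝ), ‖ν‖ = 1 ∧ (∀ n, ContDiff ℝ ∞ (η n)) ∧
      (∀ n, HasCompactSupport (η n)) ∧ (∀ n x, 0 ≤ η n x) ∧ (∀ n x, η n x ≤ 1) ∧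
      (∀ n x, η n x ≠ 0 → 0 < planeCross (p - o) (x - o) ∧ 0 < planeCross (x - o) (q - o)) ∧
      Tendsto (fun n => ∫ x in E, fderiv ℝ (η n) x ν) atTop (𝓝 (dist p q)) := by
  set c := planeCross (p - o) (q - o) with hcdef
  have hne : p ≠ q := by
    rintro rfl
    simp [c, planeCross, mul_comm] at hpq
  set l := dist p q
  have hl : 0 < l := dist_pos.2 hne
  have hτ : ‖l⁻¹ • (q - p)‖ = 1 := by
    rw [norm_smul, ← dist_eq_norm, dist_comm, norm_inv, Real.norm_of_nonneg hl.le]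
    exact inv_mul_cancel₀ hl.ne'
  obtain ⟨b, hb0, hb1⟩ := exists_orthonormalBasis_of_unit hτ
  set τ := l⁻¹ • (q - p) with hτdef
  have hq_eq : q = p + l • τ := by
    rw [hτdef, smul_smul, mul_inv_cancel₀ hl.ne', one_smul, add_sub_cancel]
  have hτ2 : τ 0 ^ 2 + τ 1 ^ 2 = 1 := by
    have := EuclideanSpace.norm_sq_eq τ
    rw [hτ, Fin.sum_univ_two] at this
    simpa using this.symm
  have hpE : p ∉ E := fun h => (hE.frontier_eq ▸ hp).2 h
  have hqE : q ∉ E := fun h => (hE.frontier_eq ▸ hq).2 h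
  -- By Cramer's rule `α / c` and `β / c` are the coordinates of `x - o` in the basis `p - o`, `q -
  -- o`. The cone is `α, β > 0` and the chord lies on `α + β = c`; `hsum` identifies the excess with
  -- the height `s` above the chord times `l`.
  let β : ℝ² → ℝ := fun x => planeCross (p - o) (x - o)
  let α : ℝ² → ℝ := fun x => planeCross (x - o) (q - o)
  have hβc : Continuous β := (continuous_planeCross_right _).comp (continuous_sub_right o)
  have hαc : Continuous α := (continuous_planeCross_left _).comp (continuous_sub_right o)
  have hcramer : ∀ x, c • (x - o) = α x • (p - o) + β x • (q - o) := fun x =>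
    planeCross_smul_eq _ _ _
  have hsum : ∀ t s : ℝ, α (p + t • b 0 + s • b 1) + β (p + t • b 0 + s • b 1) = c + s * l := by
    intro t s
    have e : c + s * l = c + s * l * (τ 0 ^ 2 + τ 1 ^ 2) := by rw [hτ2, mul_one]
    rw [e, hb0, hb1]
    simp only [α, β, hcdef, hq_eq, planeCross, PiLp.sub_apply, PiLp.add_apply, PiLp.smul_apply,
      smul_eq_mul, Matrix.cons_val_zero, Matrix.cons_val_one]
    ring
  have hα0 : ∀ t : ℝ, l * α (p + t • b 0 + (0 : ℝ) • b 1) = c * (l - t) := by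
    intro t
    rw [hb0]
    simp only [α, hcdef, hq_eq, planeCross, PiLp.sub_apply, PiLp.add_apply, PiLp.smul_apply,
      smul_eq_mul]
    ring
  have hβ0 : ∀ t : ℝ, l * β (p + t • b 0 + (0 : ℝ) • b 1) = c * t := by
    intro t
    rw [hb0]
    simp only [β, hcdef, hq_eq, planeCross, PiLp.sub_apply, PiLp.add_apply, PiLp.smul_apply,
      smul_eq_mul]
    ring
  have hα0' : ∀ t ∈ Set.Ioo 0 l, 0 < α (p + t • b 0 + (0 : ℝ) • b 1) := fun t ht =>
    pos_of_mul_pos_right (by rw [hα0]; exact mul_pos hpq (sub_pos.2 ht.2)) hl.le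
  have hβ0' : ∀ t ∈ Set.Ioo 0 l, 0 < β (p + t • b 0 + (0 : ℝ) • b 1) := fun t ht =>
    pos_of_mul_pos_right (by rw [hβ0]; exact mul_pos hpq ht.1) hl.le
  have hpcl := frontier_subset_closure hp
  have hqcl := frontier_subset_closure hq
  have hin : ∀ x, 0 ≤ α x → 0 ≤ β x → α x + β x < c → x ∈ E := by
    intro x h1 h2 h3
    have := Convex.add_smul_add_smul_mem hE hc ho hpcl hqcl (u := α x / c) (v := β x / c)
      (by positivity) (by positivity) (by rw [← add_div]; exact (div_lt_one hpq).2 h3)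
    convert this using 1
    have h4 : x - o = c⁻¹ • (c • (x - o)) := by rw [smul_smul, inv_mul_cancel₀ hpq.ne', one_smul]
    rw [hcramer x] at h4
    rw [add_assoc, ← sub_eq_iff_eq_add', h4]
    module
  have hslice : ∀ t ∈ Set.Ioo 0 l, ∀ᶠ s : ℝ in 𝓝[<] 0, p + t • b 0 + s • b 1 ∈ E := by
    intro t ht
    have h1 : ∀ᶠ s : ℝ in 𝓝 0, 0 < α (p + t • b 0 + s • b 1) :=
      (Continuous.tendsto (f := fun s : ℝ => α (p + t • b 0 + s • b 1)) (by fun_prop) 0).eventually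
        (lt_mem_nhds (hα0' t ht))
    have h2 : ∀ᶠ s : ℝ in 𝓝 0, 0 < β (p + t • b 0 + s • b 1) :=
      (Continuous.tendsto (f := fun s : ℝ => β (p + t • b 0 + s • b 1)) (by fun_prop) 0).eventually
        (lt_mem_nhds (hβ0' t ht))
    filter_upwards [h1.filter_mono nhdsWithin_le_nhds, h2.filter_mono nhdsWithin_le_nhds,
      self_mem_nhdsWithin] with s h3 h4 h5
    exact hin _ h3.le h4.le (by rw [hsum]; nlinarith [Set.mem_Iio.1 h5])
  obtain ⟨R, hR⟩ := hb.subset_ball o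
  -- The open cone over the chord, cut down to the strip orthogonal to the chord so that only
  -- abscissae in `(0, l)` contribute, and to a disc so that the cutoffs have compact support.
  let U : Set ℝ² := {x | (0 < β x ∧ 0 < α x) ∧
    (0 < inner ℝ (b 0) (x - p) ∧ inner ℝ (b 0) (x - p) < l) ∧ dist x o < R + 1}
  have hUo : IsOpen U := by
    have hi : Continuous fun x : ℝ² => (inner ℝ (b 0) (x - p) : ℝ) := by fun_prop
    have hd : Continuous fun x : ℝ² => dist x o := by fun_prop
    exact ((isOpen_lt continuous_const hβc).and (isOpen_lt continuous_const hαc)).and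
      (((isOpen_lt continuous_const hi).and (isOpen_lt hi continuous_const)).and
        (isOpen_lt hd continuous_const))
  have hUb : Bornology.IsBounded U := isBounded_ball.subset fun x hx => mem_ball.2 hx.2.2
  have hcoord : ∀ t s : ℝ, inner ℝ (b 0) (p + t • b 0 + s • b 1 - p) = t := by
    intro t s
    rw [add_assoc, add_sub_cancel_left]
    simp [inner_add_right, inner_smul_right]
  obtain ⟨η, h1, h2, h3, h4, h5, h6⟩ := exists_cutoff_tendsto_one hUo hUb
  refine ⟨b 1, η, b.norm_eq_one 1, h1, h2, h3, h4, fun n x hx => ?_, ?_⟩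
  · have : x ∈ U := by
      by_contra h
      exact hx (h5 n x h)
    exact this.1
  refine tendsto_setIntegral_fderiv hE hc hb (p := p) hl.le (U := U) (fun t s hts => ?_)
    (fun t ht => (hslice t ht).exists) (fun t ht s hs => ?_) (fun t ht s hs hmem => ?_)
    h1 h3 h4 h5 h6
  · have := hts.2.1
    rwa [hcoord] at this
  · have hs0 : 0 ≤ s := by
      refine le_of_tendsto (x := 𝓝[<] (0 : ℝ)) (f := fun s : ℝ => s) nhdsWithin_le_nhds ?_
      filter_upwards [hslice t ht] with s' hs'
      exact hs.1 hs'
    have hcl : p + t • b 0 + s • b 1 ∈ closure E := by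
      have := hs.mem_closure (hslice t ht).exists
      exact (Continuous.closure_preimage_subset (f := fun s : ℝ => p + t • b 0 + s • b 1)
        (by fun_prop) E) this
    have hsx := hsum t s
    have hα0t := hα0' t ht
    have hβ0t := hβ0' t ht
    refine ⟨?_, by rwa [hcoord], ?_⟩
    · rcases hs0.eq_or_lt with rfl | hspos
      · exact ⟨hβ0t, hα0t⟩
      set x := p + t • b 0 + s • b 1
      have hsl : 0 < s * l := mul_pos hspos hl
      constructor
      -- If the exit point `x` had left the cone across the ray through `q`'s opposite side `β = 0`,
      -- then `p` would be a combination of `o`, `x` and `q` with positive weight on `o`, hence in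
      -- `E`. The other side is symmetric.
      · by_contra! hneg
        have hα1 : c < α x := by linarith
        have hαpos : 0 < α x := hpq.trans hα1
        apply hpE
        have := Convex.add_smul_add_smul_mem hE hc ho hcl hqcl (u := c / α x) (v := -β x / α x)
          (by positivity) (div_nonneg (by linarith) hαpos.le)
          (by rw [← add_div, div_lt_one hαpos]; linarith)
        convert this using 1
        have h7 : p - o = (α x)⁻¹ • (c • (x - o) - β x • (q - o)) := by
          rw [hcramer x, add_sub_cancel_right, smul_smul, inv_mul_cancel₀ hαpos.ne', one_smul]
        rw [add_assoc, ← sub_eq_iff_eq_add', h7]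
        module
      · by_contra! hneg
        have hβ1 : c < β x := by linarith
        have hβpos : 0 < β x := hpq.trans hβ1
        apply hqE
        have := Convex.add_smul_add_smul_mem hE hc ho hcl hpcl (u := c / β x) (v := -α x / β x)
          (by positivity) (div_nonneg (by linarith) hβpos.le)
          (by rw [← add_div, div_lt_one hβpos]; linarith)
        convert this using 1
        have h7 : q - o = (β x)⁻¹ • (c • (x - o) - α x • (p - o)) := by
          rw [hcramer x, add_sub_cancel_left, smul_smul, inv_mul_cancel₀ hβpos.ne', one_smul]
        rw [add_assoc, ← sub_eq_iff_eq_add', h7]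
        module
    · have := closure_minimal (hR.trans ball_subset_closedBall) isClosed_closedBall hcl
      rw [mem_closedBall] at this
      linarith
  -- The entry point lies below the chord. In `U` it would be inside the triangle `o p q`, hence in
  -- the open set `E`, and the slice would extend further down.
  · obtain ⟨s', hs'E, hs'0⟩ := ((hslice t ht).and self_mem_nhdsWithin).exists
    have hsneg : s < 0 := (hs.1 hs'E).trans_lt hs'0
    have hxE : p + t • b 0 + s • b 1 ∈ E :=
      hin _ hmem.1.2.le hmem.1.1.le (by rw [hsum]; nlinarith)
    have hev : ∀ᶠ u : ℝ in 𝓝 s, p + t • b 0 + u • b 1 ∈ E :=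
      (Continuous.tendsto (f := fun s : ℝ => p + t • b 0 + s • b 1) (by fun_prop) s).eventually
        (hE.mem_nhds hxE)
    obtain ⟨u, huE, hu⟩ := ((hev.filter_mono nhdsWithin_le_nhds).and
      (self_mem_nhdsWithin (a := s) (s := Set.Iio s))).exists
    exact absurd (hs.1 huE) (not_le.2 hu)

theorem divergence_sum_smul {ι : Type*} (S : Finset ι) {η : ι → ℝ² → ℝ} {ν : ι → ℝ²}
    (hη : ∀ i ∈ S, ContDiff ℝ ∞ (η i)) (x : ℝ²) :
    divergence (fun x => ∑ i ∈ S, η i x • ν i) x = ∑ i ∈ S, fderiv ℝ (η i) x (ν i) := by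
  have hd : HasFDerivAt (fun x => ∑ i ∈ S, η i x • ν i)
      (∑ i ∈ S, (fderiv ℝ (η i) x).smulRight (ν i)) x :=
    HasFDerivAt.fun_sum fun i hi =>
      ((hη i hi).differentiable (by simp) x).hasFDerivAt.smul_const (ν i)
  unfold divergence
  rw [hd.fderiv]
  simp only [_root_.sum_apply, ContinuousLinearMap.smulRight_apply]
  rw [Fin.sum_univ_two]
  simp only [WithLp.ofLp_sum, Finset.sum_apply, PiLp.smul_apply, smul_eq_mul]
  rw [← Finset.sum_add_distrib]
  refine Finset.sum_congr rfl fun i _ => ?_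
  have hν : ν i = ν i 0 • EuclideanSpace.single 0 1 + ν i 1 • EuclideanSpace.single 1 1 := by
    ext j
    fin_cases j <;> simp
  conv_rhs => rw [hν, map_add, map_smul, map_smul, smul_eq_mul, smul_eq_mul]
  ring

/-- Chords spanned from an interior point by disjoint cones have total length at most the
perimeter. -/
theorem sum_dist_le_perimeter (hE : IsOpen E) (hc : Convex ℝ E) (hb : Bornology.IsBounded E)
    {o : ℝ²} (ho : o ∈ E) {ι : Type*} (S : Finset ι) {p q : ι → ℝ²}
    (hp : ∀ i ∈ S, p i ∈ frontier E) (hq : ∀ i ∈ S, q i ∈ frontier E)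
    (hpq : ∀ i ∈ S, 0 < planeCross (p i - o) (q i - o))
    (hdisj : ∀ i ∈ S, ∀ j ∈ S, ∀ v, 0 < planeCross (p i - o) v → 0 < planeCross v (q i - o) →
      0 < planeCross (p j - o) v → 0 < planeCross v (q j - o) → i = j) :
    ENNReal.ofReal (∑ i ∈ S, dist (p i) (q i)) ≤ perimeter E := by
  have hex := fun i hi => exists_testField_chord hE hc hb ho (hp i hi) (hq i hi) (hpq i hi)
  choose! ν η hν hη hηc hη0 hη1 hcone hlim using hex
  have hsmooth : ∀ n, ContDiff ℝ ∞ fun x => ∑ i ∈ S, η i n x • ν i := fun n =>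
    ContDiff.sum fun i hi => (hη i hi n).smul contDiff_const
  have hsupp : ∀ n, HasCompactSupport fun x => ∑ i ∈ S, η i n x • ν i := by
    intro n
    refine HasCompactSupport.intro (K := ⋃ i ∈ S, tsupport (η i n))
      (S.isCompact_biUnion fun i hi => hηc i hi n) fun x hx => ?_
    refine Finset.sum_eq_zero fun i hi => ?_
    have : x ∉ tsupport (η i n) := fun h => hx (Set.mem_biUnion hi h)
    rw [image_eq_zero_of_notMem_tsupport this, zero_smul]
  have hnorm : ∀ n x, ‖∑ i ∈ S, η i n x • ν i‖ ≤ 1 := by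
    intro n x
    by_cases hall : ∀ i ∈ S, η i n x = 0
    · rw [Finset.sum_eq_zero fun i hi => by rw [hall i hi, zero_smul]]
      simp
    · push Not at hall
      obtain ⟨i, hi, hix⟩ := hall
      -- The cones are disjoint, so at most one summand is nonzero at each point; this is what keeps
      -- the norm of the sum at most `1`.
      rw [Finset.sum_eq_single_of_mem i hi, norm_smul, hν i hi, mul_one,
        Real.norm_of_nonneg (hη0 i hi n x)]
      · exact hη1 i hi n x
      · intro j hj hji
        by_contra hne
        have hjx : η j n x ≠ 0 := fun h => hne (by rw [h, zero_smul])
        have c1 := hcone i hi n x hix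
        have c2 := hcone j hj n x hjx
        exact hji (hdisj i hi j hj _ c1.1 c1.2 c2.1 c2.2).symm
  have hint : ∀ n, ∫ x in E, divergence (fun x => ∑ i ∈ S, η i n x • ν i) x =
      ∑ i ∈ S, ∫ x in E, fderiv ℝ (η i n) x (ν i) := by
    intro n
    simp_rw [divergence_sum_smul S fun i hi => hη i hi n]
    exact integral_finsetSum _ fun i hi => (integrable_indicator_iff hE.measurableSet).1
      (integrable_indicator_fderiv hE hb (hη i hi n) _)
  have hT : Tendsto (fun n => ENNReal.ofReal
      (∫ x in E, divergence (fun x => ∑ i ∈ S, η i n x • ν i) x)) atTop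
      (𝓝 (ENNReal.ofReal (∑ i ∈ S, dist (p i) (q i)))) := by
    simp_rw [hint]
    exact (ENNReal.continuous_ofReal.tendsto _).comp (tendsto_finsetSum _ fun i hi => hlim i hi)
  exact le_of_tendsto' hT fun n => le_perimeter_of_testField (hsmooth n) (hsupp n) (hnorm n)

end PolygonBound

/-! ### The boundary as a rectifiable polar curve, and its arc length parametrization -/

section PolarCurve

open Metric Filter Topology

local notation "ℝ²" => EuclideanSpace ℝ (Fin 2)

/-- The unit vector of the plane with polar angle `θ`. -/
noncomputable def polarDir (θ : ℝ) : EuclideanSpace ℝ (Fin 2) := !₂[Real.cos θ, Real.sin θ]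

theorem norm_polarDir (θ : ℝ) : ‖polarDir θ‖ = 1 := by
  rw [EuclideanSpace.norm_eq, Fin.sum_univ_two]
  simp [polarDir]

theorem planeCross_smul_polarDir (a b α β : ℝ) :
    planeCross (a • polarDir α) (b • polarDir β) = a * b * Real.sin (β - α) := by
  simp only [planeCross, polarDir, PiLp.smul_apply, smul_eq_mul, Matrix.cons_val_zero,
    Matrix.cons_val_one, Real.sin_sub]
  ring

theorem exists_eq_norm_smul_polarDir (v : ℝ²) :
    ∃ ψ ∈ Set.Ico 0 (2 * Real.pi), v = ‖v‖ • polarDir ψ := by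
  let z : ℂ := ⟨v 0, v 1⟩
  have hz : ‖z‖ = ‖v‖ := by
    rw [EuclideanSpace.norm_eq, Fin.sum_univ_two, Complex.norm_def, Complex.normSq_apply]
    simp [z, sq]
  have key : ∀ ψ : ℝ, Real.cos ψ = Real.cos z.arg → Real.sin ψ = Real.sin z.arg →
      v = ‖v‖ • polarDir ψ := by
    intro ψ h1 h2
    have h3 := Complex.norm_mul_cos_arg z
    have h4 := Complex.norm_mul_sin_arg z
    rw [hz] at h3 h4
    ext i
    fin_cases i
    · simp [polarDir, h1, h3, z]
    · simp [polarDir, h2, h4, z]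
  rcases le_or_gt 0 z.arg with h | h
  · exact ⟨z.arg, ⟨h, by linarith [Complex.arg_le_pi z, Real.pi_pos]⟩, key _ rfl rfl⟩
  · exact ⟨z.arg + 2 * Real.pi, ⟨by linarith [Complex.neg_pi_lt_arg z, Real.pi_pos], by linarith⟩,
      key _ (Real.cos_add_two_pi _) (Real.sin_add_two_pi _)⟩

/-- Being positively oriented with respect to two directions less than `π` apart means having a
polar angle between theirs. -/
theorem mem_Ioo_of_sin_pos {a b ψ : ℝ} (ha : 0 ≤ a) (hb : b ≤ 2 * Real.pi)
    (hab1 : a < b) (hab2 : b - a < Real.pi) (hψ : ψ ∈ Set.Ico 0 (2 * Real.pi))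
    (h1 : 0 < Real.sin (ψ - a)) (h2 : 0 < Real.sin (b - ψ)) : ψ ∈ Set.Ioo a b := by
  have key : ∀ x : ℝ, -(2 * Real.pi) < x → x ≤ 2 * Real.pi → 0 < Real.sin x →
      (0 < x ∧ x < Real.pi) ∨ x < -Real.pi := by
    intro x hx1 hx2 hx
    rcases lt_or_ge x (-Real.pi) with h | h
    · exact Or.inr h
    rcases le_or_gt x 0 with h0 | h0
    · exact absurd (Real.sin_nonpos_of_nonpos_of_neg_pi_le h0 h) (not_le.2 hx)
    rcases lt_or_ge x Real.pi with h3 | h3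
    · exact Or.inl ⟨h0, h3⟩
    · have : 0 ≤ Real.sin (x - Real.pi) :=
        Real.sin_nonneg_of_nonneg_of_le_pi (by linarith) (by linarith)
      rw [Real.sin_sub_pi] at this
      linarith
  obtain ⟨hψ1, hψ2⟩ := hψ
  rcases key _ (by linarith) (by linarith) h1 with h3 | h3 <;>
    rcases key _ (by linarith) (by linarith) h2 with h4 | h4
  · exact ⟨by linarith, by linarith⟩
  all_goals linarith

/-- The boundary point of `E` seen from `o` in direction `θ`, for `E` convex around `o`. -/
noncomputable def polarCurve (E : Set (EuclideanSpace ℝ (Fin 2))) (o : EuclideanSpace ℝ (Fin 2)) (θ : ℝ) :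
    EuclideanSpace ℝ (Fin 2) :=
  o + (gauge ((fun v => o + v) ⁻¹' E) (polarDir θ))⁻¹ • polarDir θ

variable {E : Set (EuclideanSpace ℝ (Fin 2))} {o : EuclideanSpace ℝ (Fin 2)}

theorem preimage_add_mem_nhds_zero (hE : IsOpen E) (ho : o ∈ E) :
    (fun v => o + v) ⁻¹' E ∈ 𝓝 (0 : ℝ²) :=
  (hE.preimage (continuous_const_add o)).mem_nhds (by simpa using ho)

theorem gauge_preimage_add_pos (hE : IsOpen E) (hb : Bornology.IsBounded E) (ho : o ∈ E)
    {v : ℝ²} (hv : v ≠ 0) : 0 < gauge ((fun v => o + v) ⁻¹' E) v := by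
  have hbd : Bornology.IsBounded ((fun v => o + v) ⁻¹' E) := by
    obtain ⟨R, hR⟩ := hb.subset_closedBall o
    refine (isBounded_closedBall (x := (0 : ℝ²)) (r := R)).subset fun v hv => ?_
    have := hR hv
    rwa [mem_closedBall, dist_self_add_left, ← mem_closedBall_zero_iff] at this
  exact (gauge_pos (absorbent_nhds_zero (preimage_add_mem_nhds_zero hE ho))
    (NormedSpace.isVonNBounded_of_isBounded ℝ hbd)).2 hv

theorem polarDir_ne_zero (θ : ℝ) : polarDir θ ≠ 0 := by
  rw [← norm_ne_zero_iff, norm_polarDir]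
  exact one_ne_zero

theorem mem_frontier_iff_gauge_eq_one (hE : IsOpen E) (hc : Convex ℝ E) (ho : o ∈ E) {x : ℝ²} :
    x ∈ frontier E ↔ gauge ((fun v => o + v) ⁻¹' E) (x - o) = 1 := by
  rw [gauge_eq_one_iff_mem_frontier (hc.translate_preimage_right o)
    (preimage_add_mem_nhds_zero hE ho)]
  have := (Homeomorph.addLeft o).preimage_frontier E
  rw [show (fun v => o + v) ⁻¹' E = (Homeomorph.addLeft o) ⁻¹' E from rfl, ← this]
  simp

theorem polarCurve_mem_frontier (hE : IsOpen E) (hc : Convex ℝ E) (hb : Bornology.IsBounded E)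
    (ho : o ∈ E) (θ : ℝ) : polarCurve E o θ ∈ frontier E := by
  have hpos := gauge_preimage_add_pos hE hb ho (polarDir_ne_zero θ)
  rw [mem_frontier_iff_gauge_eq_one hE hc ho, polarCurve, add_sub_cancel_left,
    gauge_smul_of_nonneg (inv_nonneg.2 hpos.le), smul_eq_mul, inv_mul_cancel₀ hpos.ne']

theorem frontier_subset_polarCurve (hE : IsOpen E) (hc : Convex ℝ E) (hb : Bornology.IsBounded E)
    (ho : o ∈ E) : frontier E ⊆ polarCurve E o '' Set.Icc 0 (2 * Real.pi) := by
  intro x hx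
  obtain ⟨ψ, hψ, hv⟩ := exists_eq_norm_smul_polarDir (x - o)
  refine ⟨ψ, Set.Ico_subset_Icc_self hψ, ?_⟩
  have h1 := (mem_frontier_iff_gauge_eq_one hE hc ho).1 hx
  have hpos := gauge_preimage_add_pos hE hb ho (polarDir_ne_zero ψ)
  rw [hv, gauge_smul_of_nonneg (norm_nonneg _), smul_eq_mul] at h1
  rw [polarCurve, inv_eq_of_mul_eq_one_left h1, ← hv, add_sub_cancel]

theorem polarCurve_add_two_pi (θ : ℝ) : polarCurve E o (θ + 2 * Real.pi) = polarCurve E o θ := by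
  simp [polarCurve, polarDir]

theorem continuous_polarCurve (hE : IsOpen E) (hc : Convex ℝ E) (hb : Bornology.IsBounded E)
    (ho : o ∈ E) : Continuous (polarCurve E o) := by
  have hd : Continuous polarDir := by
    unfold polarDir
    refine (PiLp.continuous_toLp 2 _).comp (continuous_pi fun i => ?_)
    fin_cases i
    · exact Real.continuous_cos
    · exact Real.continuous_sin
  have hg : Continuous (gauge ((fun v => o + v) ⁻¹' E)) :=
    continuous_gauge (hc.translate_preimage_right o) (preimage_add_mem_nhds_zero hE ho)
  exact continuous_const.add (((hg.comp hd).inv₀ fun θ =>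
    (gauge_preimage_add_pos hE hb ho (polarDir_ne_zero θ)).ne').smul hd)

/-- The boundary curve of a convex set is rectifiable and its length is at most the perimeter. -/
theorem eVariationOn_polarCurve_le (hE : IsOpen E) (hc : Convex ℝ E) (hb : Bornology.IsBounded E)
    (ho : o ∈ E) :
    eVariationOn (polarCurve E o) (Set.Icc 0 (2 * Real.pi)) ≤ perimeter E := by
  rw [eVariationOn.eVariationOn_eq_strictMonoOn]
  refine iSup_le ?_
  rintro ⟨n, u, hu, hmem⟩
  simp only
  -- Each step of the partition is cut in three, so that every angle is at most `2π/3 < π`, as the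
  -- description of cones by signs of `planeCross` requires. By the triangle inequality this only
  -- lengthens the polygon.
  let d : ℕ → ℝ := fun i => (u (i + 1) - u i) / 3
  let a : ℕ × ℕ → ℝ := fun k => u k.1 + k.2 * d k.1
  let b : ℕ × ℕ → ℝ := fun k => u k.1 + (k.2 + 1) * d k.1
  let S := Finset.range n ×ˢ Finset.range 3
  have hd : ∀ i < n, 0 < d i := fun i hi =>
    div_pos (sub_pos.2 (hu (Set.mem_Iic.2 hi.le) (Set.mem_Iic.2 hi) i.lt_succ_self)) three_pos
  have hS : ∀ k ∈ S, k.1 < n ∧ k.2 < 3 := fun k hk => by simpa [S] using hk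
  have hle : ∀ i j, i ≤ j → j ≤ n → u i ≤ u j := fun i j hij hj =>
    hu.monotoneOn (Set.mem_Iic.2 (hij.trans hj)) (Set.mem_Iic.2 hj) hij
  have hb_le : ∀ k ∈ S, b k ≤ u (k.1 + 1) := by
    intro k hk
    obtain ⟨h1, h2⟩ := hS k hk
    have h3 : (k.2 : ℝ) + 1 ≤ 3 := by exact_mod_cast h2
    have h4 : u (k.1 + 1) = u k.1 + 3 * d k.1 := by simp only [d]; ring
    rw [h4]
    exact add_le_add_right (mul_le_mul_of_nonneg_right h3 (hd _ h1).le) _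
  have ha_ge : ∀ k ∈ S, u k.1 ≤ a k := fun k hk =>
    le_add_of_nonneg_right (mul_nonneg (Nat.cast_nonneg _) (hd _ (hS k hk).1).le)
  have hab : ∀ k, b k - a k = d k.1 := fun k => by simp only [a, b]; ring
  have ha0 : ∀ k ∈ S, 0 ≤ a k := fun k hk =>
    (hmem k.1 (Set.mem_Iic.2 (hS k hk).1.le)).1.trans (ha_ge k hk)
  have hb2 : ∀ k ∈ S, b k ≤ 2 * Real.pi := fun k hk =>
    (hb_le k hk).trans (hmem (k.1 + 1) (Set.mem_Iic.2 (hS k hk).1)).2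
  have hab1 : ∀ k ∈ S, a k < b k := fun k hk => by linarith [hab k, hd k.1 (hS k hk).1]
  have hab2 : ∀ k ∈ S, b k - a k < Real.pi := by
    intro k hk
    rw [hab]
    have h1 := (hmem k.1 (Set.mem_Iic.2 (hS k hk).1.le)).1
    have h2 := (hmem (k.1 + 1) (Set.mem_Iic.2 (hS k hk).1)).2
    simp only [d]
    linarith [Real.pi_pos]
  have hdisj : ∀ k ∈ S, ∀ k' ∈ S, ∀ ψ, ψ ∈ Set.Ioo (a k) (b k) → ψ ∈ Set.Ioo (a k') (b k') →
      k = k' := by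
    have hlt : ∀ k ∈ S, ∀ k' ∈ S, (k.1 < k'.1 ∨ k.1 = k'.1 ∧ k.2 < k'.2) → b k ≤ a k' := by
      rintro ⟨i, j⟩ hk ⟨i', j'⟩ hk' (h | ⟨h1, h2⟩)
      · exact (hb_le _ hk).trans ((hle _ _ h (hS _ hk').1.le).trans (ha_ge _ hk'))
      · simp only at h1 h2
        subst h1
        have h3 : (j : ℝ) + 1 ≤ j' := by exact_mod_cast h2
        exact add_le_add_right (mul_le_mul_of_nonneg_right h3 (hd _ (hS _ hk).1).le) _
    intro k hk k' hk' ψ h1 h2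
    by_contra hne
    have hcases : (k.1 < k'.1 ∨ k.1 = k'.1 ∧ k.2 < k'.2) ∨
        (k'.1 < k.1 ∨ k'.1 = k.1 ∧ k'.2 < k.2) := by
      have : ¬ (k.1 = k'.1 ∧ k.2 = k'.2) := fun h => hne (Prod.ext h.1 h.2)
      omega
    rcases hcases with h | h
    · linarith [hlt k hk k' hk' h, h1.2, h2.1]
    · linarith [hlt k' hk' k hk h, h2.2, h1.1]
  have hρ : ∀ θ, 0 < (gauge ((fun v => o + v) ⁻¹' E) (polarDir θ))⁻¹ := fun θ =>
    inv_pos.2 (gauge_preimage_add_pos hE hb ho (polarDir_ne_zero θ))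
  have hsub : ∀ θ, polarCurve E o θ - o =
      (gauge ((fun v => o + v) ⁻¹' E) (polarDir θ))⁻¹ • polarDir θ := fun θ => by
    rw [polarCurve, add_sub_cancel_left]
  have hmain := sum_dist_le_perimeter hE hc hb ho S (p := fun k => polarCurve E o (a k))
    (q := fun k => polarCurve E o (b k))
    (fun k _ => polarCurve_mem_frontier hE hc hb ho _)
    (fun k _ => polarCurve_mem_frontier hE hc hb ho _)
    (fun k hk => by
      rw [hsub, hsub, planeCross_smul_polarDir]
      exact mul_pos (mul_pos (hρ _) (hρ _))
        (Real.sin_pos_of_pos_of_lt_pi (sub_pos.2 (hab1 k hk)) (hab2 k hk)))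
    (fun k hk k' hk' v h1 h2 h3 h4 => by
      obtain ⟨ψ, hψ, hv⟩ := exists_eq_norm_smul_polarDir v
      rw [hsub, hv, planeCross_smul_polarDir] at h1 h2 h3 h4
      have hn : 0 ≤ ‖v‖ := norm_nonneg v
      have hsin : ∀ {x s : ℝ}, 0 ≤ x → 0 < x * s → 0 < s := fun hx h => pos_of_mul_pos_right h hx
      exact hdisj k hk k' hk' ψ
        (mem_Ioo_of_sin_pos (ha0 k hk) (hb2 k hk) (hab1 k hk) (hab2 k hk) hψ
          (hsin (mul_nonneg (hρ _).le hn) h1) (hsin (mul_nonneg hn (hρ _).le) h2))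
        (mem_Ioo_of_sin_pos (ha0 k' hk') (hb2 k' hk') (hab1 k' hk') (hab2 k' hk') hψ
          (hsin (mul_nonneg (hρ _).le hn) h3) (hsin (mul_nonneg hn (hρ _).le) h4)))
  refine le_trans ?_ hmain
  simp_rw [edist_dist]
  rw [← ENNReal.ofReal_sum_of_nonneg fun _ _ => dist_nonneg]
  refine ENNReal.ofReal_le_ofReal ?_
  rw [Finset.sum_product]
  refine Finset.sum_le_sum fun i _ => ?_
  have := dist_le_range_sum_dist (fun j : ℕ => polarCurve E o (u i + j * d i)) 3
  rw [dist_comm]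
  have e : u i + (3 : ℕ) * d i = u (i + 1) := by
    simp only [d]
    push_cast
    ring
  rw [e] at this
  simpa [a, b] using this

/-- A continuous curve of length at most `L` has a reparametrization on `[0, L]` with Lipschitz
constant `1`. -/
theorem exists_lipschitz_reparametrization {X : Type*} [MetricSpace X] {γ : ℝ → X} {T : ℝ}
    (hT : 0 ≤ T) (hγ : Continuous γ) {L : ℝ} (hL : 0 ≤ L)
    (hvar : eVariationOn γ (Set.Icc 0 T) ≤ ENNReal.ofReal L) :
    ∃ f : ℝ → X, (∀ s t, dist (f s) (f t) ≤ |s - t|) ∧ f 0 = γ 0 ∧ f L = γ T ∧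
      γ '' Set.Icc 0 T = f '' Set.Icc 0 L := by
  set S := Set.Icc 0 T
  have hbv : BoundedVariationOn γ S := ne_top_of_le_ne_top ENNReal.ofReal_ne_top hvar
  have hlbv := hbv.locallyBoundedVariationOn
  have h0S : (0 : ℝ) ∈ S := Set.left_mem_Icc.2 hT
  have hTS : T ∈ S := Set.right_mem_Icc.2 hT
  let V : ℝ → ℝ := variationOnFromTo γ S 0
  have hV0 : V 0 = 0 := variationOnFromTo.self γ S 0
  have hVmono : MonotoneOn V S := variationOnFromTo.monotoneOn hlbv h0S
  have hVL : V T ≤ L := by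
    have : V T = (eVariationOn γ (S ∩ Set.Icc 0 T)).toReal := variationOnFromTo.eq_of_le γ S hT
    rw [this]
    refine ENNReal.toReal_le_of_le_ofReal hL ?_
    rwa [Set.inter_self]
  have hVT : 0 ≤ V T := variationOnFromTo.nonneg_of_le γ S hT
  -- Arc length is continuous since `γ` is; so it takes every value in `[0, V T]` and each can be
  -- pulled back to a parameter.
  have hVcont : ContinuousOn V S := by
    intro x hx
    have hl : Tendsto V (𝓝[S ∩ Set.Iio x] x) (𝓝 (V x)) := by
      have := variationOnFromTo.tendsto_left (l := γ x) h0S hx hlbv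
        (hγ.continuousWithinAt)
      simpa [V] using this
    have hr : Tendsto V (𝓝[S ∩ Set.Ioi x] x) (𝓝 (V x)) := by
      have := variationOnFromTo.tendsto_right (l := γ x) h0S hx hlbv
        (hγ.continuousWithinAt)
      simpa [V] using this
    have hS : S ⊆ insert x (S ∩ Set.Iio x ∪ S ∩ Set.Ioi x) := by
      intro y hy
      rcases lt_trichotomy y x with h | h | h
      · exact Or.inr (Or.inl ⟨hy, h⟩)
      · exact Or.inl h
      · exact Or.inr (Or.inr ⟨hy, h⟩)
    exact (continuousWithinAt_insert_self.2 (ContinuousWithinAt.union hl hr)).mono hS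
  have hdist : ∀ x ∈ S, ∀ y ∈ S, dist (γ x) (γ y) ≤ |V x - V y| := by
    have hle : ∀ x ∈ S, ∀ y ∈ S, x ≤ y → dist (γ x) (γ y) ≤ V y - V x := by
      intro x hx y hy hxy
      have h1 : V y - V x = variationOnFromTo γ S x y := by
        have := variationOnFromTo.add hlbv h0S hx hy
        simp only [V]
        linarith
      rw [h1, variationOnFromTo.eq_of_le γ S hxy, dist_edist]
      exact ENNReal.toReal_mono (hlbv x y hx hy)
        (eVariationOn.edist_le γ ⟨hx, le_rfl, hxy⟩ ⟨hy, hxy, le_rfl⟩)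
    intro x hx y hy
    rcases le_total x y with h | h
    · rw [abs_sub_comm]
      exact (hle x hx y hy h).trans (le_abs_self _)
    · rw [dist_comm]
      exact (hle y hy x hx h).trans (le_abs_self _)
  have hsurj : ∀ s ∈ Set.Icc 0 (V T), ∃ x ∈ S, V x = s := by
    intro s hs
    rw [← hV0] at hs
    exact intermediate_value_Icc hT hVcont hs
  choose! θ hθS hθV using hsurj
  -- Clamping to `[0, V T]` makes the new curve rest at its end point when the length is smaller
  -- than `L`. The choice of `θ` is immaterial, since parameters with equal arc length have equal
  -- images.
  let P : ℝ → ℝ := fun s => Set.projIcc 0 (V T) hVT s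
  have hP : ∀ s, P s ∈ Set.Icc 0 (V T) := fun s => (Set.projIcc 0 (V T) hVT s).2
  have heq : ∀ x ∈ S, ∀ s, P s = V x → γ (θ (P s)) = γ x := by
    intro x hx s hs
    have := hdist _ (hθS _ (hP s)) x hx
    rw [hθV _ (hP s), hs, sub_self, abs_zero] at this
    rw [hs]
    exact dist_le_zero.1 this
  refine ⟨fun s => γ (θ (P s)), fun s t => ?_, heq 0 h0S 0 ?_, heq T hTS L ?_, ?_⟩
  · have h1 := hdist _ (hθS _ (hP s)) _ (hθS _ (hP t))
    rw [hθV _ (hP s), hθV _ (hP t)] at h1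
    exact h1.trans (Set.abs_projIcc_sub_projIcc hVT)
  · rw [hV0]
    simp [P]
  · simp only [P]
    rw [Set.projIcc_of_right_le hVT hVL]
  · apply Set.Subset.antisymm
    · rintro _ ⟨x, hx, rfl⟩
      have hVx : V x ∈ Set.Icc 0 (V T) := ⟨hV0 ▸ hVmono h0S hx hx.1, hVmono hx hTS hx.2⟩
      refine ⟨V x, ⟨hVx.1, hVx.2.trans hVL⟩, heq x hx (V x) ?_⟩
      simp only [P]
      rw [Set.projIcc_of_mem hVT hVx]
    · rintro _ ⟨s, -, rfl⟩
      exact ⟨_, hθS _ (hP s), rfl⟩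

end PolarCurve

/-! ### The boundary loop, its momentum and the nearby disc -/

section BoundaryLoop

open Metric Filter Topology AddCircle

local notation "ℝ²" => EuclideanSpace ℝ (Fin 2)

/-- A Lipschitz curve on `[0, T]` with equal end points extends to a Lipschitz periodic curve. -/
theorem dist_comp_toIcoMod_le {X : Type*} [PseudoMetricSpace X] {f : ℝ → X} {T K : ℝ} (hT : 0 < T)
    (hK : 0 ≤ K) (hf : ∀ s t, dist (f s) (f t) ≤ K * |s - t|) (h0 : f 0 = f T) (x y : ℝ) :
    dist (f (toIcoMod hT 0 x)) (f (toIcoMod hT 0 y)) ≤ K * |x - y| := by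
  wlog hxy : x ≤ y generalizing x y
  · rw [dist_comm, abs_sub_comm]
    exact this y x (le_of_not_ge hxy)
  have hx := toIcoMod_mem_Ico hT 0 x
  have hy := toIcoMod_mem_Ico hT 0 y
  have ex := toIcoMod_add_toIcoDiv_zsmul hT 0 x
  have ey := toIcoMod_add_toIcoDiv_zsmul hT 0 y
  rw [zsmul_eq_mul] at ex ey
  rw [zero_add] at hx hy
  set a := toIcoMod hT 0 x
  set b := toIcoMod hT 0 y
  set m := toIcoDiv hT 0 x
  set n := toIcoDiv hT 0 y
  rcases lt_trichotomy m n with h | h | h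
  · have h1 : (m : ℝ) + 1 ≤ n := by exact_mod_cast h
    have h2 : ((m : ℝ) + 1) * T ≤ n * T := mul_le_mul_of_nonneg_right h1 hT.le
    have h3 := hf a T
    have h4 := hf 0 b
    rw [abs_of_nonpos (by linarith [hx.2])] at h3
    rw [abs_of_nonpos (by linarith [hy.1]), h0] at h4
    calc _ ≤ _ := dist_triangle _ (f T) _
      _ ≤ K * -(a - T) + K * -(0 - b) := add_le_add h3 h4
      _ = K * (T - a + b) := by ring
      _ ≤ K * |x - y| := by
        refine mul_le_mul_of_nonneg_left ?_ hK
        rw [abs_of_nonpos (by linarith)]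
        linarith
  · have h1 := hf a b
    rwa [show a - b = x - y by rw [← ex, ← ey, h]; ring] at h1
  · have h1 : (n : ℝ) + 1 ≤ m := by exact_mod_cast h
    have h2 : ((n : ℝ) + 1) * T ≤ m * T := mul_le_mul_of_nonneg_right h1 hT.le
    linarith [hx.1, hy.2]

variable {E : Set (EuclideanSpace ℝ (Fin 2))}

/-- The boundary points seen from `o` in two opposite directions are distinct, and the boundary
curve joins them with length at most the perimeter. -/
theorem perimeter_pos_of_convex (hE : IsOpen E) (hc : Convex ℝ E) (hb : Bornology.IsBounded E)
    (hne : E.Nonempty) : 0 < perimeter E := by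
  obtain ⟨o, ho⟩ := hne
  have hpi := Real.pi_pos
  have hγ : polarCurve E o 0 ≠ polarCurve E o Real.pi := by
    intro h
    have h1 := congr_arg (fun v : ℝ² => v 0) h
    have p1 := inv_pos.2 (gauge_preimage_add_pos hE hb ho (polarDir_ne_zero 0))
    have p2 := inv_pos.2 (gauge_preimage_add_pos hE hb ho (polarDir_ne_zero Real.pi))
    simp only [polarCurve, PiLp.add_apply, PiLp.smul_apply, smul_eq_mul] at h1
    have e1 : polarDir 0 0 = 1 := by simp [polarDir]
    have e2 : polarDir Real.pi 0 = -1 := by simp [polarDir]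
    rw [e1, e2] at h1
    linarith
  exact (edist_pos.2 hγ).trans_le
    ((eVariationOn.edist_le (polarCurve E o) (s := Set.Icc 0 (2 * Real.pi)) ⟨le_rfl, by linarith⟩ ⟨hpi.le, by linarith⟩).trans
      (eVariationOn_polarCurve_le hE hc hb ho))

/-- The boundary of a bounded open convex set is a closed curve of length at most the
perimeter. -/
theorem exists_boundary_loop (hE : IsOpen E) (hc : Convex ℝ E) (hb : Bornology.IsBounded E)
    (hne : E.Nonempty) :
    ∃ g : AddCircle (2 * Real.pi) → ℝ², Continuous g ∧ Set.range g = frontier E ∧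
      ∀ x (h : ℝ), dist (g (x + h)) (g x) ≤ (perimeter E).toReal / (2 * Real.pi) * |h| := by
  obtain ⟨o, ho⟩ := hne
  have htop := perimeter_ne_top_of_convex hE hc hb
  set L := (perimeter E).toReal with hLdef
  have hL : 0 < L := ENNReal.toReal_pos (perimeter_pos_of_convex hE hc hb ⟨o, ho⟩).ne' htop
  have hT := Real.two_pi_pos
  set r := L / (2 * Real.pi) with hr
  have hrpos : 0 < r := by positivity
  have hrT : r * (2 * Real.pi) = L := div_mul_cancel₀ _ hT.ne'
  obtain ⟨f, hf, hf0, hfL, hfim⟩ := exists_lipschitz_reparametrization hT.le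
    (continuous_polarCurve hE hc hb ho) hL.le
    (by rw [ENNReal.ofReal_toReal htop]; exact eVariationOn_polarCurve_le hE hc hb ho)
  have hfr : f '' Set.Icc 0 L = frontier E := by
    rw [← hfim]
    refine Set.Subset.antisymm ?_ (frontier_subset_polarCurve hE hc hb ho)
    rintro _ ⟨θ, -, rfl⟩
    exact polarCurve_mem_frontier hE hc hb ho θ
  have hclosed : f (r * 0) = f (r * (2 * Real.pi)) := by
    rw [mul_zero, hrT, hf0, hfL, ← polarCurve_add_two_pi 0, zero_add]
  have hlip : ∀ s t, dist (f (r * s)) (f (r * t)) ≤ r * |s - t| := fun s t => by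
    refine (hf _ _).trans (le_of_eq ?_)
    rw [← mul_sub, abs_mul, abs_of_pos hrpos]
  have hGlip := dist_comp_toIcoMod_le (f := fun s => f (r * s)) hT hrpos.le hlip hclosed
  have hper : Function.Periodic (fun y => f (r * toIcoMod hT 0 y)) (2 * Real.pi) := fun y => by
    simp only [toIcoMod_add_right]
  have hcont : Continuous fun y => f (r * toIcoMod hT 0 y) :=
    (LipschitzWith.of_dist_le_mul (K := ⟨r, hrpos.le⟩) fun x y => hGlip x y).continuous
  refine ⟨hper.lift, continuous_coinduced_dom.2 hcont, ?_, fun x h => ?_⟩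
  · rw [← hfr]
    apply Set.Subset.antisymm
    · rintro _ ⟨x, rfl⟩
      induction x using QuotientAddGroup.induction_on with
      | H y =>
        have hy := toIcoMod_mem_Ico hT 0 y
        rw [zero_add] at hy
        refine ⟨r * toIcoMod hT 0 y, ⟨mul_nonneg hrpos.le hy.1, ?_⟩, rfl⟩
        rw [← hrT]
        exact mul_le_mul_of_nonneg_left hy.2.le hrpos.le
    · rintro _ ⟨s, hs, rfl⟩
      rcases hs.2.eq_or_lt with rfl | hlt
      · refine ⟨((0 : ℝ) : AddCircle (2 * Real.pi)), ?_⟩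
        rw [hper.lift_coe, toIcoMod_apply_left, hclosed, hrT]
      · refine ⟨((s / r : ℝ) : AddCircle (2 * Real.pi)), ?_⟩
        have : toIcoMod hT 0 (s / r) = s / r := by
          rw [toIcoMod_eq_self, zero_add]
          refine ⟨div_nonneg hs.1 hrpos.le, ?_⟩
          rw [div_lt_iff₀ hrpos, mul_comm, hrT]
          exact hlt
        rw [hper.lift_coe, this, mul_div_cancel₀ _ hrpos.ne']
  · induction x using QuotientAddGroup.induction_on with
    | H y =>
      have := hGlip (y + h) y
      rw [add_sub_cancel_left] at this
      exact this

/-- The length measure on the image of a Lipschitz loop is controlled by the parametrization. -/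
theorem setIntegral_hausdorffMeasure_range_le {X : Type*} [MetricSpace X] [MeasurableSpace X]
    [BorelSpace X] {g : AddCircle (2 * Real.pi) → X} (hg : Continuous g) {r : ℝ} (hr : 0 ≤ r)
    (hlip : ∀ x (h : ℝ), dist (g (x + h)) (g x) ≤ r * |h|) {u : X → ℝ} (hu : Continuous u)
    (hu0 : ∀ x, 0 ≤ u x) :
    ∫ x in Set.range g, u x ∂(Measure.hausdorffMeasure 1) ≤
      r * (2 * Real.pi) * ∫ x, u (g x) ∂haarAddCircle := by
  let G : ℝ → X := fun y => g (y : AddCircle (2 * Real.pi))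
  let J : Set ℝ := Set.Ioc 0 (0 + 2 * Real.pi)
  have hGc : Continuous G := hg.comp (AddCircle.continuous_mk' _)
  have hGlip : LipschitzWith (Real.toNNReal r) G := LipschitzWith.of_dist_le_mul fun x y => by
    have := hlip (y : AddCircle (2 * Real.pi)) (x - y)
    rw [← AddCircle.coe_add, add_sub_cancel] at this
    rwa [Real.coe_toNNReal r hr, Real.dist_eq]
  have himage : ∀ B : Set X, B ∩ Set.range g ⊆ G '' (G ⁻¹' B ∩ J) := by
    rintro B _ ⟨hB, x, rfl⟩
    obtain ⟨y, hy, rfl⟩ : ∃ y ∈ J, (y : AddCircle (2 * Real.pi)) = x := by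
      have := AddCircle.coe_image_Ioc_eq (2 * Real.pi) 0
      exact (Set.ext_iff.1 this x).2 trivial
    exact ⟨y, ⟨hB, hy⟩, rfl⟩
  have hrange : MeasurableSet (Set.range g) := (isCompact_range hg).isClosed.measurableSet
  -- An `r`-Lipschitz map enlarges one-dimensional Hausdorff measure by a factor of at most `r`. An
  -- inequality suffices, so injectivity of the loop plays no role.
  have hle : (Measure.hausdorffMeasure 1 : Measure X).restrict (Set.range g) ≤
      Measure.map G (ENNReal.ofReal r • (volume.restrict J)) := by
    refine Measure.le_iff.2 fun B hB => ?_
    rw [Measure.restrict_apply hB, Measure.map_apply hGc.measurable hB, Measure.smul_apply,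
      Measure.restrict_apply (hGc.measurable hB)]
    refine (measure_mono (himage B)).trans
      ((hGlip.hausdorffMeasure_image_le zero_le_one _).trans (le_of_eq ?_))
    rw [hausdorffMeasure_real, ENNReal.rpow_one, smul_eq_mul]
    rfl
  have hint : Integrable u (Measure.map G (ENNReal.ofReal r • (volume.restrict J))) := by
    rw [integrable_map_measure hu.aestronglyMeasurable hGc.aemeasurable]
    refine Integrable.smul_measure ?_ ENNReal.ofReal_ne_top
    exact ((hu.comp hGc).continuousOn.integrableOn_Icc (a := 0) (b := 0 + 2 * Real.pi)).mono_set
      Set.Ioc_subset_Icc_self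
  refine (integral_mono_measure hle (ae_of_all _ hu0) hint).trans (le_of_eq ?_)
  rw [integral_map hGc.aemeasurable hu.aestronglyMeasurable, integral_smul_measure,
    ENNReal.toReal_ofReal hr, ← intervalIntegral.integral_of_le (by linarith [Real.two_pi_pos]),
    AddCircle.intervalIntegral_preimage (2 * Real.pi) 0 (fun x => u (g x)), integral_haarAddCircle,
    smul_eq_mul, smul_eq_mul]
  have := Real.two_pi_pos.ne'
  field_simp

theorem infBoundaryMomentum_le (E : Set ℝ²) (x₀ : ℝ²) :
    infBoundaryMomentum E ≤ ∫ x in frontier E, ‖x - x₀‖ ^ 2 ∂(Measure.hausdorffMeasure 1) :=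
  ciInf_le ⟨0, by rintro _ ⟨y, rfl⟩; exact integral_nonneg fun x => by positivity⟩ x₀

theorem asymmetryIndex_sq_le {d : Set ℝ² → Set ℝ² → ℝ} (hd : ∀ A B, 0 ≤ d A B) {x₀ : ℝ²}
    {r ε : ℝ} (hr : 0 < r) (hper : perimeter (ball x₀ r) = perimeter E)
    (hε : d E (ball x₀ r) ≤ ε) : asymmetryIndex d E ^ 2 ≤ (ε / r) ^ 2 := by
  have hnn : ∀ t ∈ {t : ℝ | ∃ (x : ℝ²) (r : ℝ), 0 < r ∧
      perimeter (ball x r) = perimeter E ∧ t = d E (ball x r) / r}, 0 ≤ t := by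
    rintro _ ⟨x, s, hs, -, rfl⟩
    exact div_nonneg (hd _ _) hs.le
  refine pow_le_pow_left₀ (Real.sInf_nonneg hnn) ?_ 2
  exact (csInf_le ⟨0, hnn⟩ ⟨x₀, r, hr, hper, rfl⟩).trans (div_le_div_of_nonneg_right hε hr.le)

/-- A bounded convex set lies within Hausdorff distance `K √δ` of a disc with the same perimeter,
where `δ` is the deficit in the upper bound for its boundary momentum. -/
theorem exists_near_ball :
    ∃ K : ℝ, 0 < K ∧ ∀ E : Set ℝ², IsOpen E → Bornology.IsBounded E → Convex ℝ E → E.Nonempty →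
      ∃ (x₀ : ℝ²) (r δ : ℝ), 0 < r ∧ 0 ≤ δ ∧ (perimeter E).toReal = 2 * Real.pi * r ∧
        perimeter (ball x₀ r) = perimeter E ∧
        infBoundaryMomentum E ≤ 2 * Real.pi * r * (r ^ 2 - δ) ∧
        closureHausdorffDist E (ball x₀ r) ≤ K * √δ ∧
        openHausdorffDist E (ball x₀ r) ≤ K * √δ := by
  obtain ⟨K, hK, hmain⟩ := exists_lipschitz_loop_near_sphere
  refine ⟨K, hK, fun E hE hb hc hne => ?_⟩
  obtain ⟨g, hg, hrange, hlip⟩ := exists_boundary_loop hE hc hb hne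
  have htop := perimeter_ne_top_of_convex hE hc hb
  have hL : 0 < (perimeter E).toReal :=
    ENNReal.toReal_pos (perimeter_pos_of_convex hE hc hb hne).ne' htop
  set r := (perimeter E).toReal / (2 * Real.pi) with hr
  have hrpos : 0 < r := by positivity
  have hLr : (perimeter E).toReal = 2 * Real.pi * r := (mul_div_cancel₀ _ (by positivity)).symm
  let ι : ℝ² ≃ₗᵢ[ℝ] ℂ := Complex.orthonormalBasisOneI.repr.symm
  -- The mean of the loop is the centre of the disc; subtracting it kills the zeroth Fourier
  -- coefficient.
  let m : ℂ := ∫ x, ι (g x) ∂haarAddCircle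
  let x₀ : ℝ² := ι.symm m
  let f : C(AddCircle (2 * Real.pi), ℂ) := ⟨fun x => ι (g x) - m, by fun_prop⟩
  have hfg : ∀ x, ‖f x‖ = dist (g x) x₀ := fun x => by
    rw [dist_eq_norm, ← ι.norm_map, map_sub, ι.apply_symm_apply]
    rfl
  have hflip : ∀ x (h : ℝ), ‖f (x + h) - f x‖ ≤ r * |h| := fun x h => by
    refine le_trans (le_of_eq ?_) (hlip x h)
    rw [dist_eq_norm, ← ι.norm_map, map_sub]
    exact congr_arg norm (sub_sub_sub_cancel_right _ _ _)
  have hf0 : fourierCoeff f 0 = 0 := by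
    simp only [fourierCoeff, neg_zero, fourier_zero, one_smul]
    change ∫ x, (ι (g x) - m) ∂haarAddCircle = 0
    rw [integral_sub (integrable_of_continuous_addCircle (by fun_prop)) (integrable_const _)]
    simp [m]
  obtain ⟨h1, h2, h3⟩ := hmain r f hrpos.le hflip hf0
  set δ := r ^ 2 - ∫ x, ‖f x‖ ^ 2 ∂haarAddCircle with hδ
  have hdist := hausdorffDist_closure_ball_and_compl_le hE hb hc hne (x₀ := x₀) (ε := K * √δ) hrpos
    (by positivity)
    (fun x hx => by
      rw [← hrange] at hx
      obtain ⟨y, rfl⟩ := hx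
      rw [← hfg]
      exact h2 y)
    (fun w hw => by
      obtain ⟨y, hy⟩ := h3 (ι w - m) (by
        rw [← hw, dist_eq_norm, ← ι.norm_map (w - x₀), map_sub, ι.apply_symm_apply])
      refine ⟨g y, hrange ▸ ⟨y, rfl⟩, ?_⟩
      rw [dist_eq_norm, ← ι.norm_map, map_sub]
      refine le_trans (le_of_eq ?_) hy
      exact congr_arg norm (sub_sub_sub_cancel_right _ _ _).symm)
  refine ⟨x₀, r, δ, hrpos, h1, hLr, ?_, ?_, hdist.1, hdist.2⟩
  · rw [perimeter_ball x₀ hrpos, ← hLr, ENNReal.ofReal_toReal htop]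
  · refine (infBoundaryMomentum_le E x₀).trans ?_
    rw [← hrange]
    refine (setIntegral_hausdorffMeasure_range_le hg hrpos.le hlip (u := fun x => ‖x - x₀‖ ^ 2)
      (by fun_prop) fun x => by positivity).trans (le_of_eq ?_)
    simp_rw [← dist_eq_norm, ← hfg, hδ]
    ring

end BoundaryLoop

/-! ### The stability inequality -/

theorem corollary1p5 :
    ∃ C : ℝ, 0 < C ∧
      ∀ E : Set (EuclideanSpace ℝ (Fin 2)),
        IsOpen E → Bornology.IsBounded E → Convex ℝ E → E.Nonempty →
          1 / (2 * Real.pi) ^ 2 - infBoundaryMomentum E / (perimeter E).toReal ^ 3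
              ≥ C * asymmetryIndex openHausdorffDist E ^ 2 ∧
          1 / (2 * Real.pi) ^ 2 - infBoundaryMomentum E / (perimeter E).toReal ^ 3
              ≥ C * asymmetryIndex closureHausdorffDist E ^ 2 := by
  obtain ⟨K, hK, hmain⟩ := exists_near_ball
  have hpi := Real.pi_pos
  -- With `P(E) = 2πr` the deficit is at least `δ / ((2π)² r²)`, while each index is at most `K√δ /
  -- r`; this constant makes the two sides match.
  refine ⟨1 / ((2 * Real.pi) ^ 2 * K ^ 2), by positivity, fun E hE hb hc hne => ?_⟩
  obtain ⟨x₀, r, δ, hr, hδ, hP, hper, hI, hcl, hop⟩ := hmain E hE hb hc hne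
  have hdeficit : 1 / ((2 * Real.pi) ^ 2 * K ^ 2) * (K * √δ / r) ^ 2 ≤
      1 / (2 * Real.pi) ^ 2 - infBoundaryMomentum E / (perimeter E).toReal ^ 3 := by
    have h1 : infBoundaryMomentum E / (perimeter E).toReal ^ 3 ≤
        2 * Real.pi * r * (r ^ 2 - δ) / (2 * Real.pi * r) ^ 3 := by
      rw [hP]
      exact div_le_div_of_nonneg_right hI (by positivity)
    have h2 : 1 / (2 * Real.pi) ^ 2 - 2 * Real.pi * r * (r ^ 2 - δ) / (2 * Real.pi * r) ^ 3 =
        1 / ((2 * Real.pi) ^ 2 * K ^ 2) * (K * √δ / r) ^ 2 := by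
      rw [div_pow (K * √δ), mul_pow K, Real.sq_sqrt hδ]
      field_simp
      ring
    linarith
  have hC : 0 ≤ 1 / ((2 * Real.pi) ^ 2 * K ^ 2) := by positivity
  exact ⟨(mul_le_mul_of_nonneg_left (asymmetryIndex_sq_le (d := openHausdorffDist)
      (fun _ _ => Metric.hausdorffDist_nonneg) hr hper hop) hC).trans hdeficit,
    (mul_le_mul_of_nonneg_left (asymmetryIndex_sq_le (d := closureHausdorffDist)
      (fun _ _ => Metric.hausdorffDist_nonneg) hr hper hcl) hC).trans hdeficit⟩
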